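/- Let $d\in\{2,3\}$ and let $\Omega\subset\mathbb R^d$ be a bounded, simply connected open set; all function spaces consist of complex-valued functions and $(u,v)_0=\int_\Omega u\overline v\,dx$. Let $H_0^s(\Omega)$ ($s=1,2$) be the closure of $C_c^\infty(\Omega)$ in $H^s(\Omega)=W^{s,2}(\Omega)$, with norm $\|\cdot\|_s$, and let $H^{-1}(\Omega)$ be the space of continuous conjugate-linear functionals $g$ on $H_0^1(\Omega)$, written $v\mapsto (g,v)_0$, with norm $\sup_{0\ne v\in H^1_0(\Omega)}|(g,v)_0|/\|v\|_1$; a function $g\in L^2(\Omega)$ is identified with the functional $v\mapsto\int_\Omega g\overline v\,dx$. Put $\mathbf H=H_0^2(\Omega)\times L^2(\Omega)$ and $\mathbf H_1=H_0^1(\Omega)\times H^{-1}(\Omega)$, so that $\mathbf H\subset\mathbf H_1$. Let $n\in W^{1,\infty}(\Omega)$ be real-valued and assume that one of the following holds (almost everywhere in $\Omega$): (C1) $n\ge 1+\delta$ for some constant $\delta>0$; then put $m=n-1$; or (C2) $c\le n\le 1-\beta$ for some constants $c,\beta>0$; then put $m=1-n$. Let $\mu>0$ be a constant with $\mu\le \frac1m$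 almost everywhere in $\Omega$. For $(u,\omega),(v,z)\in\mathbf H$ and $(f,g)\in\mathbf H_1$ let $$A((u,\omega),(v,z))=\Big(\big(\tfrac1m-\mu\big)\Delta u,\Delta v\Big)_0+\mu\int_\Omega\sum_{1\le i,j\le d}\frac{\partial^2u}{\partial x_i\partial x_j}\frac{\partial^2\overline v}{\partial x_i\partial x_j}\,dx+(\omega,z)_0,$$ $$B((f,g),(v,z))=\Big(\nabla\big(\tfrac1mf\big),\nabla v\Big)_0+\Big(\nabla f,\nabla\big(\tfrac nmv\big)\Big)_0-\Big(\tfrac nm g,v\Big)_0+(f,z)_0,$$ where $(\tfrac nm g,v)_0$ means $(g,\tfrac nm v)_0$. **Theorem 2.2.** The form $B$ is well defined, in the sense that $\frac1m f$ and $\frac nm f$ belong to $H_0^1(\Omega)$ for every $f\in H_0^1(\Omega)$. For every $(f,g)\in\mathbf H_1$ there is exactly one $T(f,g)\in\mathbf H$ with $$A(T(f,g),(v,z))=B((f,g),(v,z))\qquad\text{for all }(v,z)\in\mathbf H,$$ and the resulting solution operator $T:\mathbf H_1\to\mathbf H$ is linear and continuous. Moreover $T$ is compact as an operator $\mathbf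 H\to\mathbf H$ (restricted to $\mathbf H$) and as an operator $\mathbf H_1\to\mathbf H_1$ (composed with the inclusion $\mathbf H\subset\mathbf H_1$). -/

import Mathlib

open MeasureTheory TopologicalSpace
open scoped Distributions ENNReal ComplexConjugate

noncomputable section

namespace TransmissionEigenvalue

/-- The Euclidean space `ℝᵈ`. -/
abbrev E (d : ℕ) : Type := EuclideanSpace ℝ (Fin d)

variable {d : ℕ}

/-- The `i`-th coordinate vector of `ℝᵈ`. -/
abbrev e (i : Fin d) : E d := EuclideanSpace.single i (1 : ℝ)

/-- Lebesgue measure on `Ω`. -/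
abbrev vol (Ω : Opens (E d)) : Measure (E d) := volume.restrict (Ω : Set (E d))

/-- The complex space `L²(Ω)`. -/
abbrev L2 (Ω : Opens (E d)) : Type := Lp ℂ 2 (vol Ω)

/-- The partial derivative `∂φ/∂xᵢ` of a test function `φ ∈ C_c^∞(Ω; ℂ)`. -/
def testDeriv {Ω : Opens (E d)} (i : Fin d) (φ : 𝓓(Ω, ℂ)) : 𝓓(Ω, ℂ) where
  toFun x := fderiv ℝ φ x (e i)
  contDiff' := (φ.contDiff.fderiv_right (m := ((⊤ : ℕ∞) : WithTop ℕ∞)) le_rfl).clm_apply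
    contDiff_const
  hasCompactSupport' := φ.hasCompactSupport.fderiv_apply ℝ (e i)
  tsupport_subset' := (tsupport_fderiv_apply_subset ℝ (e i)).trans φ.tsupport_subset

/-- `g` is the weak derivative `∂u/∂xᵢ` on `Ω`:
`∫_Ω u ∂ᵢφ = -∫_Ω g φ` for all test functions `φ`. It is only used for `u`, `g` in `L²(Ω)` or in
`L^∞(Ω)`, so that the integrals converge. -/
def IsWeakDeriv (Ω : Opens (E d)) (i : Fin d) (u g : E d → ℂ) : Prop :=
  ∀ φ : 𝓓(Ω, ℂ), ∫ x in (Ω : Set (E d)), u x * testDeriv i φ x =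
    -∫ x in (Ω : Set (E d)), g x * φ x

/-- The real function `n` belongs to `W^{1,∞}(Ω)`. -/
def MemW1Infty (Ω : Opens (E d)) (n : E d → ℝ) : Prop :=
  MemLp n ∞ (vol Ω) ∧ ∀ i : Fin d, ∃ g : E d → ℝ, MemLp g ∞ (vol Ω) ∧
    IsWeakDeriv Ω i (fun x => (n x : ℂ)) (fun x => (g x : ℂ))

theorem memLp_test {Ω : Opens (E d)} (φ : 𝓓(Ω, ℂ)) : MemLp φ 2 (vol Ω) :=
  φ.continuous.memLp_of_hasCompactSupport φ.hasCompactSupport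

/-- A test function as an element of `L²(Ω)`. -/
def testL2 {Ω : Opens (E d)} (φ : 𝓓(Ω, ℂ)) : L2 Ω := (memLp_test φ).toLp φ

theorem integrable_mul_test {Ω : Opens (E d)} (u : L2 Ω) (φ : 𝓓(Ω, ℂ)) :
    Integrable (fun x => u x * φ x) (vol Ω) :=
  (Lp.memLp u).integrable_mul (memLp_test φ)

theorem IsWeakDeriv.congr {Ω : Opens (E d)} {i : Fin d} {u u' g g' : E d → ℂ}
    (h : IsWeakDeriv Ω i u g) (hu : u' =ᵐ[vol Ω] u) (hg : g' =ᵐ[vol Ω] g) :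
    IsWeakDeriv Ω i u' g' := by
  intro φ
  rw [integral_congr_ae (g := fun x => u x * testDeriv i φ x) (by
      filter_upwards [hu] with x hx; rw [hx]),
    integral_congr_ae (f := fun x => g' x * φ x) (g := fun x => g x * φ x) (by
      filter_upwards [hg] with x hx; rw [hx])]
  exact h φ

theorem IsWeakDeriv.add {Ω : Opens (E d)} {i : Fin d} {u v g h : L2 Ω}
    (hu : IsWeakDeriv Ω i u g) (hv : IsWeakDeriv Ω i v h) :
    IsWeakDeriv Ω i (u + v : L2 Ω) (g + h : L2 Ω) := by
  refine IsWeakDeriv.congr (u := fun x => u x + v x) (g := fun x => g x + h x) ?_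
    (Lp.coeFn_add u v) (Lp.coeFn_add g h)
  intro φ
  simp only [add_mul]
  rw [integral_add (integrable_mul_test u _) (integrable_mul_test v _),
    integral_add (integrable_mul_test g _) (integrable_mul_test h _), hu φ, hv φ]
  ring

theorem IsWeakDeriv.smul {Ω : Opens (E d)} {i : Fin d} {u g : L2 Ω} (c : ℂ)
    (hu : IsWeakDeriv Ω i u g) : IsWeakDeriv Ω i (c • u : L2 Ω) (c • g : L2 Ω) := by
  refine IsWeakDeriv.congr (u := fun x => c * u x) (g := fun x => c * g x) ?_
    (Lp.coeFn_smul c u) (Lp.coeFn_smul c g)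
  intro φ
  simp only [mul_assoc]
  rw [integral_const_mul, integral_const_mul, hu φ]
  ring

theorem isWeakDeriv_zero (Ω : Opens (E d)) (i : Fin d) :
    IsWeakDeriv Ω i (0 : L2 Ω) (0 : L2 Ω) := by
  refine IsWeakDeriv.congr (u := fun _ => 0) (g := fun _ => 0) ?_
    (Lp.coeFn_zero _ _ _) (Lp.coeFn_zero _ _ _)
  intro φ
  simp

theorem isWeakDeriv_test {Ω : Opens (E d)} (i : Fin d) (φ : 𝓓(Ω, ℂ)) :
    IsWeakDeriv Ω i (testL2 φ) (testL2 (testDeriv i φ)) := by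
  refine IsWeakDeriv.congr (u := φ) (g := testDeriv i φ) ?_
    (memLp_test φ).coeFn_toLp (memLp_test _).coeFn_toLp
  intro ψ
  have key : ∀ α β : 𝓓(Ω, ℂ), ∀ x, x ∉ (Ω : Set (E d)) → α x * β x = 0 := by
    intro α β x hx
    rw [image_eq_zero_of_notMem_tsupport (fun h => hx (α.tsupport_subset h)), zero_mul]
  have int : ∀ α β : 𝓓(Ω, ℂ), Integrable (fun x => α x * β x) volume := fun α β =>
    (α.continuous.mul β.continuous).integrable_of_hasCompactSupport
      (α.hasCompactSupport.mul_right)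
  rw [setIntegral_eq_integral_of_forall_compl_eq_zero (key φ (testDeriv i ψ)),
    setIntegral_eq_integral_of_forall_compl_eq_zero (key (testDeriv i φ) ψ)]
  exact integral_mul_fderiv_eq_neg_fderiv_mul_of_integrable (int (testDeriv i φ) ψ)
    (int φ (testDeriv i ψ)) (int φ ψ)
    (fun x _ => (φ.contDiff.differentiable (by simp)) x)
    (fun x _ => (ψ.contDiff.differentiable (by simp)) x)

/-- First-order jets: pairs `(u, (uᵢ)ᵢ)` in `L²(Ω) × L²(Ω)ᵈ`, with the Hilbert norm
`(‖u‖₀² + ∑ᵢ ‖uᵢ‖₀²)^{1/2}`. -/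
abbrev Jet1 (Ω : Opens (E d)) : Type := WithLp 2 (L2 Ω × PiLp 2 (fun _ : Fin d => L2 Ω))

/-- Second-order jets `((u, (uᵢ)ᵢ), (uᵢⱼ)ᵢⱼ)`, with the Hilbert norm
`(‖u‖₀² + ∑ᵢ ‖uᵢ‖₀² + ∑ᵢⱼ ‖uᵢⱼ‖₀²)^{1/2}`. -/
abbrev Jet2 (Ω : Opens (E d)) : Type :=
  WithLp 2 (Jet1 Ω × PiLp 2 (fun _ : Fin d × Fin d => L2 Ω))

/-- The Sobolev space `H¹(Ω) = W^{1,2}(Ω)`. An element `u` is stored together with its weak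
gradient (which `u` determines) as the jet `(u, ∇u)`; the norm is the usual one,
`‖u‖₁ = (‖u‖₀² + ∑ᵢ ‖∂ᵢu‖₀²)^{1/2}`. -/
def H1 (Ω : Opens (E d)) : Submodule ℂ (Jet1 Ω) where
  carrier := {U | ∀ i, IsWeakDeriv Ω i U.fst (U.snd i)}
  add_mem' hU hV i := (hU i).add (hV i)
  zero_mem' i := isWeakDeriv_zero Ω i
  smul_mem' c _ hU i := (hU i).smul c

/-- The Sobolev space `H²(Ω) = W^{2,2}(Ω)`: an element `u` is stored as the jet
`((u, ∇u), (∂²u/∂xᵢ∂xⱼ)ᵢⱼ)` of its weak derivatives, so `‖u‖₂` is the norm of this jet. -/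
def H2 (Ω : Opens (E d)) : Submodule ℂ (Jet2 Ω) where
  carrier := {U | U.fst ∈ H1 Ω ∧ ∀ i j, IsWeakDeriv Ω j (U.fst.snd i) (U.snd (i, j))}
  add_mem' hU hV := ⟨(H1 Ω).add_mem hU.1 hV.1, fun i j => (hU.2 i j).add (hV.2 i j)⟩
  zero_mem' := ⟨(H1 Ω).zero_mem, fun _ j => isWeakDeriv_zero Ω j⟩
  smul_mem' c _ hU := ⟨(H1 Ω).smul_mem c hU.1, fun i j => (hU.2 i j).smul c⟩

/-- The jet `(φ, ∇φ)` of a test function. -/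
def testJet1 {Ω : Opens (E d)} (φ : 𝓓(Ω, ℂ)) : Jet1 Ω :=
  WithLp.toLp 2 (testL2 φ, WithLp.toLp 2 fun i => testL2 (testDeriv i φ))

/-- The jet `((φ, ∇φ), D²φ)` of a test function. -/
def testJet2 {Ω : Opens (E d)} (φ : 𝓓(Ω, ℂ)) : Jet2 Ω :=
  WithLp.toLp 2 (testJet1 φ, WithLp.toLp 2 fun p => testL2 (testDeriv p.2 (testDeriv p.1 φ)))

theorem testJet1_mem_H1 {Ω : Opens (E d)} (φ : 𝓓(Ω, ℂ)) : testJet1 φ ∈ H1 Ω :=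
  fun i => isWeakDeriv_test i φ

theorem testJet2_mem_H2 {Ω : Opens (E d)} (φ : 𝓓(Ω, ℂ)) : testJet2 φ ∈ H2 Ω :=
  ⟨testJet1_mem_H1 φ, fun i j => isWeakDeriv_test j (testDeriv i φ)⟩

/-- `H₀¹(Ω)`, the closure of `C_c^∞(Ω)` in `H¹(Ω)`. -/
def H10 (Ω : Opens (E d)) : Submodule ℂ (Jet1 Ω) :=
  H1 Ω ⊓ (Submodule.span ℂ (Set.range (testJet1 (Ω := Ω)))).topologicalClosure

/-- `H₀²(Ω)`, the closure of `C_c^∞(Ω)` in `H²(Ω)`. -/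
def H20 (Ω : Opens (E d)) : Submodule ℂ (Jet2 Ω) :=
  H2 Ω ⊓ (Submodule.span ℂ (Set.range (testJet2 (Ω := Ω)))).topologicalClosure

/-- The inclusion `H₀¹(Ω) → L²(Ω)`. -/
def H10.toL2 (Ω : Opens (E d)) : H10 Ω →L[ℂ] L2 Ω :=
  (WithLp.fstL 2 ℂ (L2 Ω) (PiLp 2 (fun _ : Fin d => L2 Ω))).comp (H10 Ω).subtypeL

/-- The weak derivative `∂u/∂xᵢ ∈ L²(Ω)` of `u ∈ H₀¹(Ω)`. -/
def H10.deriv {Ω : Opens (E d)} (u : H10 Ω) (i : Fin d) : L2 Ω := u.1.snd i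

/-- The weak derivative `∂²u/∂xᵢ∂xⱼ ∈ L²(Ω)` of `u ∈ H₀²(Ω)`. -/
def H20.deriv2 {Ω : Opens (E d)} (u : H20 Ω) (i j : Fin d) : L2 Ω := u.1.snd (i, j)

/-- The Laplacian `Δu ∈ L²(Ω)` of `u ∈ H₀²(Ω)`. -/
def H20.laplacian {Ω : Opens (E d)} (u : H20 Ω) : L2 Ω := ∑ i, H20.deriv2 u i i

/-- Forgetting the second derivatives. -/
def jetFst (Ω : Opens (E d)) : Jet2 Ω →L[ℂ] Jet1 Ω :=
  WithLp.fstL 2 ℂ (Jet1 Ω) (PiLp 2 (fun _ : Fin d × Fin d => L2 Ω))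

theorem jetFst_mem {Ω : Opens (E d)} (u : H20 Ω) : jetFst Ω u.1 ∈ H10 Ω := by
  refine ⟨u.2.1.1, map_mem_closure (jetFst Ω).continuous u.2.2 ?_⟩
  intro x hx
  have : Submodule.span ℂ (Set.range (testJet2 (Ω := Ω))) ≤
      (Submodule.span ℂ (Set.range (testJet1 (Ω := Ω)))).comap (jetFst Ω).toLinearMap := by
    rw [Submodule.span_le]
    rintro _ ⟨φ, rfl⟩
    exact Submodule.subset_span ⟨φ, rfl⟩
  exact this hx

/-- The inclusion `H₀²(Ω) → H₀¹(Ω)`. -/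
def H20.toH10 (Ω : Opens (E d)) : H20 Ω →L[ℂ] H10 Ω :=
  ((jetFst Ω).comp (H20 Ω).subtypeL).codRestrict (H10 Ω) jetFst_mem

/-- The negative space `H^{-1}(Ω)`: the continuous conjugate-linear functionals on `H₀¹(Ω)`, where
`g v` is the pairing `(g, v)₀`. Its norm is the operator norm `sup_{v ≠ 0} |(g, v)₀| / ‖v‖₁`. -/
abbrev Hneg1 (Ω : Opens (E d)) : Type := H10 Ω →L⋆[ℂ] ℂ

/-- The inclusion `L²(Ω) → H^{-1}(Ω)`, sending `z` to the functional `v ↦ (z, v)₀ = ∫_Ω z v̄`. -/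
def L2toHneg1 (Ω : Opens (E d)) : L2 Ω →L[ℂ] Hneg1 Ω :=
  ((innerSL ℂ (E := L2 Ω)).comp (H10.toL2 Ω)).flip

/-- `𝐇 = H₀²(Ω) × L²(Ω)`. -/
abbrev HH (Ω : Opens (E d)) : Type := H20 Ω × L2 Ω

/-- `𝐇₁ = H₀¹(Ω) × H^{-1}(Ω)`. -/
abbrev HH1 (Ω : Opens (E d)) : Type := H10 Ω × Hneg1 Ω

/-- The inclusion `𝐇 → 𝐇₁`. -/
def incl (Ω : Opens (E d)) : HH Ω →L[ℂ] HH1 Ω := (H20.toH10 Ω).prodMap (L2toHneg1 Ω)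

/-- `w ∈ H₀¹(Ω)` is the pointwise product `q u` of `u ∈ H₀¹(Ω)` with the real function `q`. -/
def IsProduct {Ω : Opens (E d)} (q : E d → ℝ) (u w : H10 Ω) : Prop :=
  H10.toL2 Ω w =ᵐ[vol Ω] fun x => (q x : ℂ) * H10.toL2 Ω u x

open Classical in
/-- The product `q u` as an element of `H₀¹(Ω)`, for a multiplier `q` of `H₀¹(Ω)`
(it is set to `0` if `q u` is not in `H₀¹(Ω)`). -/
def mulH10 {Ω : Opens (E d)} (q : E d → ℝ) (u : H10 Ω) : H10 Ω :=
  if h : ∃ w : H10 Ω, IsProduct q u w then h.choose else 0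

/-- Condition (C1) on the index of refraction. -/
def CondC1 (Ω : Opens (E d)) (n : E d → ℝ) : Prop :=
  MemLp n ∞ (vol Ω) ∧ ∃ δ : ℝ, 0 < δ ∧ ∀ᵐ x ∂(vol Ω), 1 + δ ≤ n x

/-- Condition (C2) on the index of refraction. -/
def CondC2 (Ω : Opens (E d)) (n : E d → ℝ) : Prop :=
  MemLp n ∞ (vol Ω) ∧ (∃ c : ℝ, 0 < c ∧ ∀ᵐ x ∂(vol Ω), c ≤ n x) ∧
    ∃ β : ℝ, 0 < β ∧ ∀ᵐ x ∂(vol Ω), n x ≤ 1 - β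

/-- The sesquilinear form
`A((u,ω),(v,z)) = ((1/m - μ) Δu, Δv)₀ + μ ∫_Ω ∑ᵢⱼ ∂ᵢ∂ⱼu ∂ᵢ∂ⱼv̄ + (ω, z)₀`,
to be used with `m = n - 1` under (C1) and `m = 1 - n` under (C2). -/
def formA (Ω : Opens (E d)) (m : E d → ℝ) (μ : ℝ) (U V : HH Ω) : ℂ :=
  (∫ x in (Ω : Set (E d)), ((1 / m x - μ : ℝ) : ℂ) * H20.laplacian U.1 x * conj (H20.laplacian V.1 x)) +
    (μ : ℂ) * (∫ x in (Ω : Set (E d)), ∑ i, ∑ j, H20.deriv2 U.1 i j x * conj (H20.deriv2 V.1 i j x)) +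
    ∫ x in (Ω : Set (E d)), U.2 x * conj (V.2 x)

/-- The sesquilinear form
`B((f,g),(v,z)) = (∇(f/m), ∇v)₀ + (∇f, ∇(n v/m))₀ - (n g/m, v)₀ + (f, z)₀`
for `(f,g) ∈ 𝐇₁` and `(v,z) ∈ 𝐇`; as `n/m` is real, `(n g/m, v)₀` is the value of the functional
`g ∈ H^{-1}(Ω)` at `n v/m ∈ H₀¹(Ω)`. -/
def formB (Ω : Opens (E d)) (n m : E d → ℝ) (F : HH1 Ω) (V : HH Ω) : ℂ :=
  let v : H10 Ω := H20.toH10 Ω V.1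
  (∫ x in (Ω : Set (E d)), ∑ i,
      H10.deriv (mulH10 (fun y => 1 / m y) F.1) i x * conj (H10.deriv v i x)) +
    (∫ x in (Ω : Set (E d)), ∑ i, H10.deriv F.1 i x *
      conj (H10.deriv (mulH10 (fun y => n y / m y) v) i x)) -
    F.2 (mulH10 (fun y => n y / m y) v) +
    ∫ x in (Ω : Set (E d)), H10.toL2 Ω F.1 x * conj (V.2 x)

end TransmissionEigenvalue

end

noncomputable section

namespace TransmissionEigenvalue

variable {d : ℕ} {Ω : Opens (E d)}

/-! The variational problem decouples. Testing with `(0, z)` forces `ω = f`, so the second component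
of `T` is the inclusion of `H₀¹` into `L²`. Testing with `(v, 0)` leaves a problem for `u` alone on
`H₀²`, solved by Lax–Milgram (`exists_inverse_of_coercive`, `exists_solution_operator`). Since `1/m
- μ ≥ 0`, the Laplacian term has nonnegative real part on the diagonal, and the Hessian term alone
gives coercivity: all `∂ᵢu` lie in `H₀¹`, so the Poincaré inequality, applied to `u` and to each
`∂ᵢu`, bounds the full `H²` norm by the second derivatives (`exists_norm_sq_H20_le`). No elliptic
regularity enters.

The right-hand side is continuous once `1/m` and `n/m` act boundedly on `H₀¹`. Multiplication by a
`W^{1,∞}` function preserves `H₀¹`: mollify the multiplier, apply the Leibniz rule to test functions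
and pass to the limit (`mulJet_test_mem`). Division by `m` needs no chain rule: with `R` an upper
bound for `m`, write `m = R(1 - r)`, `|r| ≤ ρ < 1`, and invert `1 - r` on `H₀¹` by a Neumann series
in an equivalent norm (`exists_inverse_one_sub`, `exists_isProduct_inv`). Finally `n/m = 1/m ± 1`.

Both compactness claims follow from compactness of the single inclusion `𝐇 → 𝐇₁`
(`isCompactOperator_incl`), composed with the continuous `T` on either side. That inclusion reduces
to Rellich's theorem for `H₀¹ → L²`: applied to `u` and to every `∂ᵢu` it gives `H₀² → H₀¹`, and
passing to the Hilbert adjoint gives `L² → H^{-1}`. Rellich itself comes from approximating the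
inclusion in operator norm by finite-rank averages over grid cells, the error being controlled by
the translation estimate `lintegral_sub_translate_le`. -/

/-! ### Multiplication operators on `L²(Ω)` -/

/-- Multiplication by a bounded function, as an operator on `L²(Ω)`. -/
def mulL2 {q : E d → ℂ} (hq : MemLp q ∞ (vol Ω)) : L2 Ω →L[ℂ] L2 Ω :=
  (ContinuousLinearMap.mul ℂ ℂ).holderL (vol Ω) ∞ 2 2 (hq.toLp q)

theorem coeFn_mulL2 {q : E d → ℂ} (hq : MemLp q ∞ (vol Ω)) (u : L2 Ω) :
    mulL2 hq u =ᵐ[vol Ω] fun x => q x * u x := by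
  have h := (ContinuousLinearMap.mul ℂ ℂ).coeFn_holder (r := 2) (hq.toLp q) u
  filter_upwards [h, hq.coeFn_toLp] with x hx hx'
  rw [← hx']
  exact hx

theorem norm_mulL2_le {q : E d → ℂ} (hq : MemLp q ∞ (vol Ω)) {ρ : ℝ}
    (hρ : ∀ᵐ x ∂(vol Ω), ‖q x‖ ≤ ρ) (u : L2 Ω) : ‖mulL2 hq u‖ ≤ ρ * ‖u‖ := by
  apply Lp.norm_le_mul_norm_of_ae_le_mul
  filter_upwards [coeFn_mulL2 hq u, hρ] with x hx hx'
  rw [hx, norm_mul]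
  gcongr

/-- The inner product here is conjugate-linear in its first slot, so `(u, v)₀` becomes `inner ℂ v
u`; this explains the swapped arguments from here on. -/
theorem inner_eq_integral (u v : L2 Ω) :
    inner ℂ u v = ∫ x in (Ω : Set (E d)), v x * conj (u x) := by
  rw [L2.inner_def]
  rfl

/-! ### Test functions -/

theorem testL2_add (φ ψ : 𝓓(Ω, ℂ)) : testL2 (φ + ψ) = testL2 φ + testL2 ψ := rfl

theorem testDeriv_add (i : Fin d) (φ ψ : 𝓓(Ω, ℂ)) :
    testDeriv i (φ + ψ) = testDeriv i φ + testDeriv i ψ := by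
  ext x
  have h1 := (φ.contDiff.differentiable (by simp)) x
  have h2 := (ψ.contDiff.differentiable (by simp)) x
  change fderiv ℝ (⇑φ + ⇑ψ) x (e i) = fderiv ℝ φ x (e i) + fderiv ℝ ψ x (e i)
  rw [fderiv_add h1 h2]
  rfl

theorem testDeriv_smul (i : Fin d) (c : ℂ) (φ : 𝓓(Ω, ℂ)) :
    testDeriv i (c • φ) = c • testDeriv i φ := by
  ext x
  have h1 := (φ.contDiff.differentiable (by simp)) x
  change fderiv ℝ (c • ⇑φ) x (e i) = c • fderiv ℝ φ x (e i)
  rw [fderiv_const_smul h1]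
  rfl

/-- The jet `(φ, ∇φ)` as a linear function of the test function `φ`. -/
def testJet1L (Ω : Opens (E d)) : 𝓓(Ω, ℂ) →ₗ[ℂ] Jet1 Ω where
  toFun := testJet1
  map_add' φ ψ := by simp only [testJet1, testDeriv_add]; rfl
  map_smul' c φ := by simp only [testJet1, testDeriv_smul]; rfl

/-- The jet `((φ, ∇φ), D²φ)` as a linear function of the test function `φ`. -/
def testJet2L (Ω : Opens (E d)) : 𝓓(Ω, ℂ) →ₗ[ℂ] Jet2 Ω where
  toFun := testJet2
  map_add' φ ψ := by
    simp only [testJet2, testJet1, testDeriv_add]; rfl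
  map_smul' c φ := by
    simp only [testJet2, testJet1, testDeriv_smul]; rfl

/-- The jet is linear in `φ`, so jets of test functions already form a subspace and density
arguments may use single test functions. -/
theorem span_range_testJet1 :
    Submodule.span ℂ (Set.range (testJet1 (Ω := Ω))) = LinearMap.range (testJet1L Ω) :=
  (Submodule.span_eq (LinearMap.range (testJet1L Ω)))

theorem span_range_testJet2 :
    Submodule.span ℂ (Set.range (testJet2 (Ω := Ω))) = LinearMap.range (testJet2L Ω) :=
  (Submodule.span_eq (LinearMap.range (testJet2L Ω)))

theorem mem_closure_testJet1 (u : H10 Ω) : u.1 ∈ closure (Set.range (testJet1 (Ω := Ω))) := by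
  have h := u.2.2
  rw [span_range_testJet1] at h
  exact h

theorem mem_closure_testJet2 (u : H20 Ω) : u.1 ∈ closure (Set.range (testJet2 (Ω := Ω))) := by
  have h := u.2.2
  rw [span_range_testJet2] at h
  exact h

theorem testJet1_mem_H10 (φ : 𝓓(Ω, ℂ)) : testJet1 φ ∈ H10 Ω :=
  ⟨testJet1_mem_H1 φ, subset_closure (Submodule.subset_span ⟨φ, rfl⟩)⟩

/-- A test function as an element of `H₀¹(Ω)`. -/
def testH10 (φ : 𝓓(Ω, ℂ)) : H10 Ω := ⟨testJet1 φ, testJet1_mem_H10 φ⟩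

theorem denseRange_testH10 : DenseRange (testH10 (Ω := Ω)) := by
  intro u
  rw [closure_subtype, ← Set.range_comp]
  exact mem_closure_testJet1 u

/-! ### Closedness of the Sobolev spaces -/

/-- The pairing is the inner product with `conj φ ∈ L²`. Weak-derivative relations are therefore
closed conditions, whence completeness of the Sobolev spaces. -/
theorem continuous_integral_mul_test (φ : 𝓓(Ω, ℂ)) :
    Continuous fun u : L2 Ω => ∫ x in (Ω : Set (E d)), u x * φ x := by
  have h : MemLp (fun x => conj (φ x)) 2 (vol Ω) := (memLp_test φ).star
  have : (fun u : L2 Ω => ∫ x in (Ω : Set (E d)), u x * φ x) =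
      fun u => inner ℂ (h.toLp _) u := by
    ext u
    rw [inner_eq_integral]
    refine integral_congr_ae ?_
    filter_upwards [h.coeFn_toLp] with x hx
    rw [hx, Complex.conj_conj]
  rw [this]
  fun_prop

theorem isClosed_setOf_isWeakDeriv {X : Type*} [TopologicalSpace X] (i : Fin d) {f g : X → L2 Ω}
    (hf : Continuous f) (hg : Continuous g) : IsClosed {x | IsWeakDeriv Ω i (f x) (g x)} := by
  simp only [IsWeakDeriv, Set.ofPred_forall]
  exact isClosed_iInter fun φ => isClosed_eq ((continuous_integral_mul_test _).comp hf)
    ((continuous_integral_mul_test φ).comp hg).neg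

theorem isClosed_H1 : IsClosed (H1 Ω : Set (Jet1 Ω)) := by
  change IsClosed {U : Jet1 Ω | ∀ i, IsWeakDeriv Ω i U.fst (U.snd i)}
  rw [Set.ofPred_forall]
  exact isClosed_iInter fun i => isClosed_setOf_isWeakDeriv i (by fun_prop) (by fun_prop)

theorem isClosed_H2 : IsClosed (H2 Ω : Set (Jet2 Ω)) := by
  change IsClosed {U : Jet2 Ω | U.fst ∈ H1 Ω ∧ ∀ i j, IsWeakDeriv Ω j (U.fst.snd i) (U.snd (i, j))}
  refine (isClosed_H1.preimage (f := fun U : Jet2 Ω => U.fst) (by fun_prop)).inter ?_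
  change IsClosed {U : Jet2 Ω | ∀ i j, IsWeakDeriv Ω j (U.fst.snd i) (U.snd (i, j))}
  simp only [Set.ofPred_forall]
  exact isClosed_iInter fun i => isClosed_iInter fun j =>
    isClosed_setOf_isWeakDeriv (f := fun U : Jet2 Ω => U.fst.snd i) (g := fun U => U.snd (i, j)) j
      (by fun_prop) (by fun_prop)

theorem isClosed_H10 : IsClosed (H10 Ω : Set (Jet1 Ω)) :=
  isClosed_H1.inter (Submodule.isClosed_topologicalClosure _)

theorem isClosed_H20 : IsClosed (H20 Ω : Set (Jet2 Ω)) :=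
  isClosed_H2.inter (Submodule.isClosed_topologicalClosure _)

instance : CompleteSpace (H10 Ω) := isClosed_H10.completeSpace_coe

instance : CompleteSpace (H20 Ω) := isClosed_H20.completeSpace_coe

/-- A continuous linear map which sends jets of test functions into `H₀¹(Ω)` maps `H₀¹(Ω)`
to itself. -/
theorem mem_H10_of_test (M : Jet1 Ω →L[ℂ] Jet1 Ω) (hM : ∀ φ, M (testJet1 φ) ∈ H10 Ω) (u : H10 Ω) :
    M u.1 ∈ H10 Ω := by
  rw [← SetLike.mem_coe, ← isClosed_H10.closure_eq]
  refine map_mem_closure M.continuous (mem_closure_testJet1 u) ?_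
  rintro _ ⟨φ, rfl⟩
  exact hM φ

/-! ### Uniqueness of weak derivatives -/

/-- This is the fundamental lemma of the calculus of variations applied to `g - h`. -/
theorem IsWeakDeriv.unique {i : Fin d} {u : E d → ℂ} {g h : L2 Ω} (hg : IsWeakDeriv Ω i u g)
    (hh : IsWeakDeriv Ω i u h) : g = h := by
  have key : ∀ᵐ x, x ∈ (Ω : Set (E d)) → (g - h : L2 Ω) x = 0 := by
    refine Ω.isOpen.ae_eq_zero_of_integral_contDiff_smul_eq_zero ?_ ?_
    · refine LocallyIntegrableOn.mono_set ?_ subset_rfl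
      exact (locallyIntegrableOn_of_locallyIntegrable_restrict
        ((Lp.memLp (g - h)).locallyIntegrable (by norm_num)))
    · intro ψ hψ hc hs
      -- The fundamental lemma tests against real functions, so `ψ` is complexified.
      let φ : 𝓓(Ω, ℂ) :=
        { toFun := fun x => (ψ x : ℂ)
          contDiff' := Complex.ofRealCLM.contDiff.comp hψ
          hasCompactSupport' := hc.comp_left (g := ((↑) : ℝ → ℂ)) Complex.ofReal_zero
          tsupport_subset' := (closure_mono (fun x hx => by
            simpa [Function.mem_support] using hx)).trans hs }
      have h0 : ∫ x in (Ω : Set (E d)), (g - h : L2 Ω) x * φ x = 0 := by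
        have : ∀ᵐ x ∂(vol Ω), (g - h : L2 Ω) x * φ x = g x * φ x - h x * φ x := by
          filter_upwards [Lp.coeFn_sub g h] with x hx
          rw [hx, Pi.sub_apply, sub_mul]
        rw [integral_congr_ae this,
          integral_sub (integrable_mul_test g φ) (integrable_mul_test h φ), sub_eq_zero]
        exact neg_injective ((hg φ).symm.trans (hh φ))
      rw [← setIntegral_eq_integral_of_forall_compl_eq_zero (s := (Ω : Set (E d))), ← h0]
      · refine integral_congr_ae (.of_forall fun x => ?_)
        change ((ψ x : ℝ) • _ : ℂ) = _ * (ψ x : ℂ)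
        rw [Complex.real_smul, mul_comm]
      · intro x hx
        rw [image_eq_zero_of_notMem_tsupport (fun h => hx (hs h)), zero_smul]
  rw [← sub_eq_zero]
  refine Lp.ext ?_
  filter_upwards [(ae_restrict_iff' Ω.isOpen.measurableSet).2 key, Lp.coeFn_zero ℂ 2 (vol Ω)]
    with x hx hx'
  rw [hx, hx']
  rfl

/-- The function determines its weak gradient, so a jet is determined by its `L²` part; uniqueness
of products rests on this. -/
theorem H10.toL2_injective : Function.Injective (H10.toL2 Ω) := by
  intro u v h
  have h' : u.1.fst = v.1.fst := h
  apply Subtype.ext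
  refine WithLp.ofLp_injective 2 (Prod.ext h' ?_)
  refine WithLp.ofLp_injective 2 (funext fun i => ?_)
  have h1 := u.2.1 i
  rw [h'] at h1
  exact h1.unique (v.2.1 i)

theorem IsProduct.unique {q : E d → ℝ} {u w w' : H10 Ω} (h : IsProduct q u w)
    (h' : IsProduct q u w') : w = w' :=
  H10.toL2_injective (Lp.ext (h.trans h'.symm))

theorem IsProduct.mulH10_eq {q : E d → ℝ} {u w : H10 Ω} (h : IsProduct q u w) :
    mulH10 q u = w := by
  have hex : ∃ w : H10 Ω, IsProduct q u w := ⟨w, h⟩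
  rw [mulH10, dif_pos hex]
  exact hex.choose_spec.unique h

/-! ### The translation estimate and the Poincaré inequality -/

/-- Cauchy–Schwarz against the constant function `1`. -/
theorem sq_lintegral_le {α : Type*} [MeasurableSpace α] {ν : Measure α} {f : α → ℝ≥0∞}
    (hf : AEMeasurable f ν) : (∫⁻ x, f x ∂ν) ^ 2 ≤ ν Set.univ * ∫⁻ x, f x ^ 2 ∂ν := by
  have h := ENNReal.lintegral_mul_le_Lp_mul_Lq ν Real.HolderConjugate.two_two hf
    (aemeasurable_const (b := (1 : ℝ≥0∞)))
  simp only [Pi.mul_apply, mul_one, lintegral_const, ENNReal.rpow_two, one_pow, one_mul] at h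
  calc (∫⁻ x, f x ∂ν) ^ 2
      ≤ ((∫⁻ x, f x ^ 2 ∂ν) ^ (1 / 2 : ℝ) * ν Set.univ ^ (1 / 2 : ℝ)) ^ 2 := by gcongr
    _ = ν Set.univ * ∫⁻ x, f x ^ 2 ∂ν := by
      rw [mul_pow, ← ENNReal.rpow_two, ← ENNReal.rpow_two, ← ENNReal.rpow_mul, ← ENNReal.rpow_mul]
      norm_num
      rw [mul_comm]

/-- Fundamental theorem of calculus along the segment from `x` to `x + z`, then Cauchy–Schwarz on
the unit interval. -/
theorem enorm_sub_translate_le {φ : E d → ℂ} (hφ : ContDiff ℝ 1 φ) (x z : E d) :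
    ‖φ (x + z) - φ x‖ₑ ^ 2 ≤ ∫⁻ t in Set.Ioc (0 : ℝ) 1, ‖fderiv ℝ φ (x + t • z) z‖ₑ ^ 2 := by
  have hc : Continuous fun t : ℝ => fderiv ℝ φ (x + t • z) z :=
    ((hφ.continuous_fderiv one_ne_zero).comp (by fun_prop)).clm_apply continuous_const
  have hd : ∀ t : ℝ, HasDerivAt (fun t : ℝ => φ (x + t • z)) (fderiv ℝ φ (x + t • z) z) t := by
    intro t
    have h1 : HasDerivAt (fun t : ℝ => x + t • z) z t := by
      simpa using ((hasDerivAt_id t).smul_const z).const_add x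
    exact ((hφ.differentiable one_ne_zero) (x + t • z)).hasFDerivAt.comp_hasDerivAt t h1
  have h := intervalIntegral.integral_eq_sub_of_hasDerivAt (a := 0) (b := 1) (fun t _ => hd t)
    (hc.intervalIntegrable 0 1)
  simp only [one_smul, zero_smul, add_zero] at h
  rw [← h, intervalIntegral.integral_of_le zero_le_one]
  calc _ ≤ (∫⁻ t in Set.Ioc (0 : ℝ) 1, ‖fderiv ℝ φ (x + t • z) z‖ₑ) ^ 2 := by
        gcongr
        exact enorm_integral_le_lintegral_enorm _
    _ ≤ _ := by
      refine (sq_lintegral_le hc.enorm.aemeasurable).trans (le_of_eq ?_)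
      simp

/-- `‖φ(· + z) - φ‖₀ ≤ ‖∂_z φ‖₀` on the whole space. -/
theorem lintegral_sub_translate_le {φ : E d → ℂ} (hφ : ContDiff ℝ 1 φ) (z : E d) :
    ∫⁻ x, ‖φ (x + z) - φ x‖ₑ ^ 2 ≤ ∫⁻ x, ‖fderiv ℝ φ x z‖ₑ ^ 2 := by
  have hc : Continuous fun p : E d × ℝ => fderiv ℝ φ (p.1 + p.2 • z) z :=
    ((hφ.continuous_fderiv one_ne_zero).comp (by fun_prop)).clm_apply continuous_const
  calc ∫⁻ x, ‖φ (x + z) - φ x‖ₑ ^ 2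
      ≤ ∫⁻ x, ∫⁻ t in Set.Ioc (0 : ℝ) 1, ‖fderiv ℝ φ (x + t • z) z‖ₑ ^ 2 :=
        lintegral_mono fun x => enorm_sub_translate_le hφ x z
    _ = ∫⁻ t in Set.Ioc (0 : ℝ) 1, ∫⁻ x, ‖fderiv ℝ φ (x + t • z) z‖ₑ ^ 2 :=
        lintegral_lintegral_swap (hc.enorm.measurable.pow_const 2).aemeasurable
    _ = ∫⁻ _t in Set.Ioc (0 : ℝ) 1, ∫⁻ x, ‖fderiv ℝ φ x z‖ₑ ^ 2 := by
        congr 1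
        ext t
        exact lintegral_add_right_eq_self (fun x => ‖fderiv ℝ φ x z‖ₑ ^ 2) (t • z)
    _ = _ := by simp

theorem enorm_L2_sq (u : L2 Ω) : ‖u‖ₑ ^ 2 = ∫⁻ x, ‖u x‖ₑ ^ 2 ∂(vol Ω) := by
  rw [Lp.enorm_def, eLpNorm_eq_lintegral_rpow_enorm_toReal (by norm_num) (by norm_num),
    ← ENNReal.rpow_two, ← ENNReal.rpow_mul]
  norm_num

/-- Extension by zero: the norm becomes an integral over all of `ℝᵈ`, where translations are
available. -/
theorem enorm_testL2_sq (φ : 𝓓(Ω, ℂ)) : ‖testL2 φ‖ₑ ^ 2 = ∫⁻ x, ‖φ x‖ₑ ^ 2 := by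
  have h1 : ∀ᵐ x ∂(vol Ω), ‖testL2 φ x‖ₑ ^ 2 = ‖φ x‖ₑ ^ 2 := by
    filter_upwards [(memLp_test φ).coeFn_toLp] with x hx
    exact congrArg (‖·‖ₑ ^ 2) hx
  rw [enorm_L2_sq, lintegral_congr_ae h1, ← lintegral_indicator Ω.isOpen.measurableSet]
  congr 1
  ext x
  by_cases hx : x ∈ (Ω : Set (E d))
  · rw [Set.indicator_of_mem hx]
  · rw [Set.indicator_of_notMem hx,
      image_eq_zero_of_notMem_tsupport (fun h => hx (φ.tsupport_subset h))]
    simp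

theorem norm_le_of_enorm_sq_le {F G : Type*} [NormedAddCommGroup F] [NormedAddCommGroup G]
    {u : F} {v : G} {c : ℝ} (hc : 0 ≤ c) (h : ‖u‖ₑ ^ 2 ≤ ENNReal.ofReal c ^ 2 * ‖v‖ₑ ^ 2) :
    ‖u‖ ≤ c * ‖v‖ := by
  rw [← mul_pow, ENNReal.pow_le_pow_left_iff two_ne_zero, ← ofReal_norm, ← ofReal_norm,
    ← ENNReal.ofReal_mul hc] at h
  exact (ENNReal.ofReal_le_ofReal_iff (by positivity)).1 h

/-- The Poincaré inequality for test functions on a set of diameter less than `R`. -/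
theorem norm_testL2_le {R : ℝ} (hR : 0 ≤ R) (hΩ : ∀ x ∈ Ω, ∀ y ∈ Ω, dist x y < R) (i : Fin d)
    (φ : 𝓓(Ω, ℂ)) : ‖testL2 φ‖ ≤ R * ‖testL2 (testDeriv i φ)‖ := by
  have hz : ∀ x ∉ Ω, φ x = 0 := fun x hx =>
    image_eq_zero_of_notMem_tsupport (fun h => hx (φ.tsupport_subset h))
  apply norm_le_of_enorm_sq_le hR
  rw [enorm_testL2_sq, enorm_testL2_sq]
  calc ∫⁻ x, ‖φ x‖ₑ ^ 2 ≤ ∫⁻ x, ‖φ (x + R • e i) - φ x‖ₑ ^ 2 := by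
        refine lintegral_mono fun x => ?_
        by_cases hx : x ∈ Ω
        -- A shift by `R` moves every point of `Ω` out of `Ω`, so the difference there is just `-φ
        -- x`.
        · rw [hz (x + R • e i), zero_sub, enorm_neg]
          intro hx'
          have := hΩ _ hx' _ hx
          rw [dist_self_add_left, norm_smul, Real.norm_of_nonneg hR] at this
          simp at this
        · rw [hz x hx]
          simp
    _ ≤ ∫⁻ x, ‖fderiv ℝ φ x (R • e i)‖ₑ ^ 2 :=
        lintegral_sub_translate_le (φ.contDiff.of_le (by exact_mod_cast le_top)) _
    _ = ENNReal.ofReal R ^ 2 * ∫⁻ x, ‖testDeriv i φ x‖ₑ ^ 2 := by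
        rw [← lintegral_const_mul' _ _ (by simp)]
        congr 1
        ext x
        rw [map_smul, enorm_smul, mul_pow, Real.enorm_of_nonneg hR]
        rfl

/-! ### Averaging over the cells of a grid -/

/-- The cell with index `k` of the cubic grid of mesh size `h`. -/
def gridCell (h : ℝ) (k : Fin d → ℤ) : Set (E d) := {x | ∀ i, ⌊x i / h⌋ = k i}

theorem measurableSet_gridCell (h : ℝ) (k : Fin d → ℤ) : MeasurableSet (gridCell h k) := by
  simp only [gridCell, Set.ofPred_forall]
  refine MeasurableSet.iInter fun i => ?_
  have : Measurable fun x : E d => ⌊x i / h⌋ := by fun_prop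
  exact this (measurableSet_singleton (k i))

theorem volume_setOf_forall_mem {s : Fin d → Set ℝ} (hs : ∀ i, MeasurableSet (s i)) :
    volume {x : E d | ∀ i, x i ∈ s i} = ∏ i, volume (s i) := by
  have h := (PiLp.volume_preserving_ofLp (Fin d)).measure_preimage
    (MeasurableSet.univ_pi hs).nullMeasurableSet
  rw [volume_pi_pi] at h
  rw [← h]
  congr 1
  ext x
  simp

theorem volume_gridCell {h : ℝ} (hh : 0 < h) (k : Fin d → ℤ) :
    volume (gridCell h k) = ENNReal.ofReal h ^ d := by
  have : gridCell h k = {x : E d | ∀ i, x i ∈ Set.Ico (k i * h) ((k i + 1) * h)} := by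
    ext x
    refine forall_congr' fun i => ?_
    rw [Int.floor_eq_iff, le_div_iff₀ hh, div_lt_iff₀ hh]
    rfl
  rw [this, volume_setOf_forall_mem fun i => measurableSet_Ico]
  simp [add_mul]

theorem volume_box (h : ℝ) :
    volume {z : E d | ∀ i, z i ∈ Set.Icc (-h) h} = (2 * ENNReal.ofReal h) ^ d := by
  rw [volume_setOf_forall_mem fun i => measurableSet_Icc]
  have : h - -h = 2 * h := by ring
  simp only [Real.volume_Icc, this, ENNReal.ofReal_mul zero_le_two, ENNReal.ofReal_ofNat,
    Finset.prod_const, Finset.card_univ, Fintype.card_fin]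

theorem sub_mem_box {h : ℝ} (hh : 0 < h) {k : Fin d → ℤ} {x y : E d} (hx : x ∈ gridCell h k)
    (hy : y ∈ gridCell h k) (i : Fin d) : (y - x) i ∈ Set.Icc (-h) h := by
  have h1 := abs_lt.1 (Int.abs_sub_lt_one_of_floor_eq_floor ((hy i).trans (hx i).symm))
  rw [← sub_div, lt_div_iff₀ hh, div_lt_iff₀ hh] at h1
  simp only [PiLp.sub_apply, Set.mem_Icc]
  constructor <;> linarith [h1.1, h1.2]

/-- The error is minus the cell average of `φ y - φ x`. After Cauchy–Schwarz on the cell, substitute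
`y = x + z`: all such `z` lie in the box `[-h, h]ᵈ`, which makes the bound independent of the cell.
-/
theorem enorm_sub_gridAverage_le {h : ℝ} (hh : 0 < h) {φ : E d → ℂ} (hφ : Continuous φ)
    (hi : Integrable φ) {k : Fin d → ℤ} {x : E d} (hx : x ∈ gridCell h k) :
    ‖φ x - ((h ^ d)⁻¹ : ℝ) • ∫ y in gridCell h k, φ y‖ₑ ^ 2 ≤
      (ENNReal.ofReal h ^ d)⁻¹ *
        ∫⁻ z in {z : E d | ∀ i, z i ∈ Set.Icc (-h) h}, ‖φ (x + z) - φ x‖ₑ ^ 2 := by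
  have hp : 0 < h ^ d := by positivity
  have hv : volume.real (gridCell h k) = h ^ d := by
    rw [measureReal_def, volume_gridCell hh, ENNReal.toReal_pow, ENNReal.toReal_ofReal hh.le]
  have h0 : ENNReal.ofReal h ^ d ≠ 0 := by simp [hh]
  have ht : ENNReal.ofReal h ^ d ≠ ⊤ := by simp
  have hfin : volume (gridCell h k) ≠ ⊤ := by rw [volume_gridCell hh]; exact ht
  have e1 : φ x - ((h ^ d)⁻¹ : ℝ) • ∫ y in gridCell h k, φ y =
      -(((h ^ d)⁻¹ : ℝ) • ∫ y in gridCell h k, (φ y - φ x)) := by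
    rw [integral_sub hi.integrableOn (integrableOn_const hfin), setIntegral_const, hv, smul_sub,
      smul_smul, inv_mul_cancel₀ hp.ne', one_smul, neg_sub]
  have e2 : ‖((h ^ d)⁻¹ : ℝ)‖ₑ = (ENNReal.ofReal h ^ d)⁻¹ := by
    rw [Real.enorm_of_nonneg (by positivity), ENNReal.ofReal_inv_of_pos hp,
      ENNReal.ofReal_pow hh.le]
  have e3 : (‖∫ y in gridCell h k, (φ y - φ x)‖ₑ) ^ 2 ≤
      ENNReal.ofReal h ^ d * ∫⁻ y in gridCell h k, ‖φ y - φ x‖ₑ ^ 2 := by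
    calc _ ≤ (∫⁻ y in gridCell h k, ‖φ y - φ x‖ₑ) ^ 2 := by
          gcongr
          exact enorm_integral_le_lintegral_enorm _
      _ ≤ _ := by
          have hc : Continuous fun y => φ y - φ x := by fun_prop
          refine (sq_lintegral_le hc.enorm.aemeasurable).trans ?_
          rw [Measure.restrict_apply_univ, volume_gridCell hh]
  have e4 : ∫⁻ y in gridCell h k, ‖φ y - φ x‖ₑ ^ 2 ≤
      ∫⁻ z in {z : E d | ∀ i, z i ∈ Set.Icc (-h) h}, ‖φ (x + z) - φ x‖ₑ ^ 2 := by
    have hm : MeasurableSet {z : E d | ∀ i, z i ∈ Set.Icc (-h) h} := by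
      simp only [Set.ofPred_forall]
      refine MeasurableSet.iInter fun i => ?_
      have : Measurable fun x : E d => x i := by fun_prop
      exact this measurableSet_Icc
    rw [← lintegral_indicator (measurableSet_gridCell h k), ← lintegral_indicator hm,
      ← lintegral_add_left_eq_self _ x]
    refine lintegral_mono fun z => ?_
    by_cases hz : x + z ∈ gridCell h k
    · have hz' : z ∈ {z : E d | ∀ i, z i ∈ Set.Icc (-h) h} := fun i => by
        simpa using sub_mem_box hh hx hz i
      rw [Set.indicator_of_mem hz, Set.indicator_of_mem hz']
    · rw [Set.indicator_of_notMem hz]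
      exact zero_le
  rw [e1, enorm_neg, enorm_smul, mul_pow, e2]
  calc _ ≤ ((ENNReal.ofReal h ^ d)⁻¹) ^ 2 *
        (ENNReal.ofReal h ^ d * ∫⁻ y in gridCell h k, ‖φ y - φ x‖ₑ ^ 2) := by gcongr
    _ = (ENNReal.ofReal h ^ d)⁻¹ * ∫⁻ y in gridCell h k, ‖φ y - φ x‖ₑ ^ 2 := by
      rw [sq, mul_assoc, ← mul_assoc _ (ENNReal.ofReal h ^ d), ENNReal.inv_mul_cancel h0 ht,
        one_mul]
    _ ≤ _ := by gcongr

theorem enorm_fderiv_sq_le {h : ℝ} {z : E d} (hz : ∀ i, z i ∈ Set.Icc (-h) h) (φ : 𝓓(Ω, ℂ))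
    (x : E d) : ‖fderiv ℝ φ x z‖ₑ ^ 2 ≤
      ENNReal.ofReal h ^ 2 * (d * ∑ i, ‖testDeriv i φ x‖ₑ ^ 2) := by
  have hz' : fderiv ℝ φ x z = ∑ i, z i • testDeriv i φ x := by
    have : z = ∑ i, z i • e i := by
      simpa using ((EuclideanSpace.basisFun (Fin d) ℝ).sum_repr z).symm
    conv_lhs => rw [this]
    rw [map_sum]
    simp only [map_smul]
    rfl
  rw [hz']
  calc ‖∑ i, z i • testDeriv i φ x‖ₑ ^ 2
      ≤ (∑ i, ENNReal.ofReal h * ‖testDeriv i φ x‖ₑ) ^ 2 := by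
        gcongr
        refine (enorm_sum_le _ _).trans (Finset.sum_le_sum fun i _ => ?_)
        rw [enorm_smul]
        gcongr
        rw [← ofReal_norm]
        exact ENNReal.ofReal_le_ofReal (abs_le.2 (hz i))
    _ = ENNReal.ofReal h ^ 2 * (∑ i, ‖testDeriv i φ x‖ₑ) ^ 2 := by
        rw [← Finset.mul_sum, mul_pow]
    _ ≤ _ := by
        gcongr
        -- Counting measure on `Fin d` turns the integral inequality into the one for finite sums,
        -- with total mass `d`.
        have := sq_lintegral_le (ν := Measure.count)
          (f := fun i : Fin d => ‖testDeriv i φ x‖ₑ) (measurable_of_finite _).aemeasurable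
        simpa [lintegral_count, tsum_fintype] using this

/-- Averaging over the cells of a grid of mesh size `h` approximates the identity. -/
theorem exists_compact_approx (hΩ : Bornology.IsBounded (Ω : Set (E d))) {h : ℝ} (hh : 0 < h) :
    ∃ P : L2 Ω →L[ℂ] L2 Ω, IsCompactOperator P ∧ ∀ φ : 𝓓(Ω, ℂ),
      ‖testL2 φ - P (testL2 φ)‖ₑ ^ 2 ≤
        2 ^ d * (ENNReal.ofReal h ^ 2 * (d * ∑ i, ‖testL2 (testDeriv i φ)‖ₑ ^ 2)) := by
  obtain ⟨R, hR⟩ := hΩ.exists_norm_le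
  have hf : ∀ k : Fin d → ℤ, vol Ω (gridCell h k) ≠ ⊤ := fun k =>
    ((Measure.restrict_apply_le _ _).trans_lt (by rw [volume_gridCell hh]; simp)).ne
  let a : (Fin d → ℤ) → L2 Ω := fun k =>
    indicatorConstLp 2 (measurableSet_gridCell h k) (hf k) 1
  -- Since `Ω` lies in the ball of radius `R`, these finitely many cells cover it.
  let K : Finset (Fin d → ℤ) := Fintype.piFinset fun _ => Finset.Icc ⌊-R / h⌋ ⌊R / h⌋
  have hK : ∀ x ∈ Ω, ∃ k ∈ K, x ∈ gridCell h k := by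
    intro x hx
    refine ⟨fun i => ⌊x i / h⌋, Fintype.mem_piFinset.2 fun i => Finset.mem_Icc.2 ?_, fun i => rfl⟩
    have := abs_le.1 ((PiLp.norm_apply_le x i).trans (hR x hx))
    exact ⟨Int.floor_le_floor (by gcongr; exact this.1), Int.floor_le_floor (by gcongr; exact this.2)⟩
  -- On each cell this takes the average of the extension by zero; a finite sum of rank-one
  -- operators is compact.
  refine ⟨∑ k ∈ K, ((h ^ d)⁻¹ : ℝ) • (innerSL ℂ (a k)).smulRight (a k), ?_, fun φ => ?_⟩
  · refine Submodule.sum_mem (compactOperator (RingHom.id ℂ) (L2 Ω) (L2 Ω)) fun k _ => ?_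
    have h1 : IsCompactOperator (ContinuousLinearMap.toSpanSingleton ℂ (a k)) :=
      isCompactOperator_of_locallyCompactSpace_rng _
    exact (h1.comp_clm (innerSL ℂ (a k))).smul ((h ^ d)⁻¹ : ℝ)
  · have hz : ∀ x ∉ Ω, φ x = 0 := fun x hx =>
      image_eq_zero_of_notMem_tsupport (fun h => hx (φ.tsupport_subset h))
    have hin : ∀ k, inner ℂ (a k) (testL2 φ) = ∫ y in gridCell h k, φ y := by
      intro k
      have hφ : ∀ᵐ x ∂(vol Ω).restrict (gridCell h k), testL2 φ x = φ x :=
        ae_restrict_of_ae (memLp_test φ).coeFn_toLp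
      rw [L2.inner_indicatorConstLp_one, integral_congr_ae hφ, Measure.restrict_restrict (measurableSet_gridCell h k)]
      exact (setIntegral_eq_of_subset_of_forall_sdiff_eq_zero (measurableSet_gridCell h k)
        Set.inter_subset_left fun x hx => hz x fun hx' => hx.2 ⟨hx.1, hx'⟩).symm
    have hsum : ∀ᵐ x ∂(vol Ω), ‖(testL2 φ - (∑ k ∈ K, ((h ^ d)⁻¹ : ℝ) •
        (innerSL ℂ (a k)).smulRight (a k)) (testL2 φ) : L2 Ω) x‖ₑ ^ 2 ≤
        (ENNReal.ofReal h ^ d)⁻¹ *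
        ∫⁻ z in {z : E d | ∀ i, z i ∈ Set.Icc (-h) h}, ‖φ (x + z) - φ x‖ₑ ^ 2 := by
      have hval : (∑ k ∈ K, ((h ^ d)⁻¹ : ℝ) • (innerSL ℂ (a k)).smulRight (a k)) (testL2 φ) =
          ∑ k ∈ K, (((h ^ d)⁻¹ : ℝ) • ∫ y in gridCell h k, φ y) • a k := by
        rw [_root_.sum_apply]
        refine Finset.sum_congr rfl fun k _ => ?_
        rw [← hin k]
        rw [smul_assoc]
        rfl
      rw [hval]
      have ha : ∀ᵐ x ∂(vol Ω), ∀ k, a k x = (gridCell h k).indicator (fun _ => (1 : ℂ)) x :=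
        ae_all_iff.2 fun k => indicatorConstLp_coeFn
      have hs : ∀ᵐ x ∂(vol Ω), ∀ k, ((((h ^ d)⁻¹ : ℝ) • ∫ y in gridCell h k, φ y) • a k : L2 Ω) x =
          (((h ^ d)⁻¹ : ℝ) • ∫ y in gridCell h k, φ y) * a k x :=
        ae_all_iff.2 fun k => Lp.coeFn_smul _ _
      filter_upwards [ha, hs, Lp.coeFn_sub (testL2 φ) (∑ k ∈ K,
        (((h ^ d)⁻¹ : ℝ) • ∫ y in gridCell h k, φ y) • a k), (memLp_test φ).coeFn_toLp,
        Lp.coeFn_fun_finsetSum K fun k => (((h ^ d)⁻¹ : ℝ) • ∫ y in gridCell h k, φ y) • a k,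
        ae_restrict_mem Ω.isOpen.measurableSet] with x h1 h2 h3 h4 h5 hx
      obtain ⟨k, hkK, hk⟩ := hK x hx
      refine le_trans (le_of_eq ?_) (enorm_sub_gridAverage_le hh φ.continuous
        (φ.continuous.integrable_of_hasCompactSupport φ.hasCompactSupport) hk)
      rw [h3, Pi.sub_apply, h5, Finset.sum_eq_single k]
      · rw [h2, h1, Set.indicator_of_mem hk, mul_one]
        congr 3
      · intro b _ hb
        rw [h2, h1, Set.indicator_of_notMem, mul_zero]
        exact fun hb' => hb (funext fun i => (hb' i).symm.trans (hk i))
      · exact fun h => absurd hkK h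
    have h0 : ENNReal.ofReal h ^ d ≠ 0 := by simp [hh]
    have ht : ENNReal.ofReal h ^ d ≠ ⊤ := by simp
    rw [enorm_L2_sq]
    calc _ ≤ ∫⁻ x, (ENNReal.ofReal h ^ d)⁻¹ *
          ∫⁻ z in {z : E d | ∀ i, z i ∈ Set.Icc (-h) h}, ‖φ (x + z) - φ x‖ₑ ^ 2 :=
          (lintegral_mono_ae hsum).trans (setLIntegral_le_lintegral _ _)
      -- Tonelli brings the `x`-integral inside, where the translation estimate applies for each
      -- fixed `z`. The box has volume `(2h)ᵈ`, so the prefactor `h⁻ᵈ` leaves `2ᵈ`.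
      _ = (ENNReal.ofReal h ^ d)⁻¹ *
          ∫⁻ z in {z : E d | ∀ i, z i ∈ Set.Icc (-h) h}, ∫⁻ x, ‖φ (x + z) - φ x‖ₑ ^ 2 := by
        rw [lintegral_const_mul' _ _ (ENNReal.inv_ne_top.2 h0), lintegral_lintegral_swap]
        have : Continuous fun p : E d × E d => φ (p.1 + p.2) - φ p.1 := by fun_prop
        exact (this.enorm.measurable.pow_const 2).aemeasurable
      _ ≤ (ENNReal.ofReal h ^ d)⁻¹ * ∫⁻ _z in {z : E d | ∀ i, z i ∈ Set.Icc (-h) h},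
          ENNReal.ofReal h ^ 2 * (d * ∑ i, ‖testL2 (testDeriv i φ)‖ₑ ^ 2) := by
        refine mul_le_mul_right ?_ _
        refine setLIntegral_mono measurable_const fun z hz => ?_
        refine (lintegral_sub_translate_le (φ.contDiff.of_le (by exact_mod_cast le_top)) z).trans ?_
        refine (lintegral_mono fun x => enorm_fderiv_sq_le hz φ x).trans (le_of_eq ?_)
        rw [lintegral_const_mul' _ _ (by simp), lintegral_const_mul' _ _ (by simp),
          lintegral_finsetSum]
        · simp only [enorm_testL2_sq]
        · exact fun i _ => (testDeriv i φ).continuous.enorm.measurable.pow_const 2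
      _ = _ := by
        rw [setLIntegral_const, volume_box, mul_comm (_ * _) (_ ^ d), ← mul_assoc, mul_pow,
          mul_comm (2 ^ d), ← mul_assoc, ← mul_assoc (_⁻¹), ENNReal.inv_mul_cancel h0 ht, one_mul,
          mul_assoc]

/-! ### Norms of jets -/

theorem norm_sq_H10 (u : H10 Ω) : ‖u‖ ^ 2 = ‖H10.toL2 Ω u‖ ^ 2 + ∑ i, ‖H10.deriv u i‖ ^ 2 := by
  change ‖u.1‖ ^ 2 = _
  rw [WithLp.prod_norm_sq_eq_of_L2, PiLp.norm_sq_eq_of_L2]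
  rfl

theorem norm_sq_H20 (u : H20 Ω) :
    ‖u‖ ^ 2 = ‖H20.toH10 Ω u‖ ^ 2 + ∑ p : Fin d × Fin d, ‖H20.deriv2 u p.1 p.2‖ ^ 2 := by
  change ‖u.1‖ ^ 2 = _
  rw [WithLp.prod_norm_sq_eq_of_L2, PiLp.norm_sq_eq_of_L2]
  rfl

/-- The partial derivative `∂ᵢ : H₀¹(Ω) → L²(Ω)`. -/
def derivL (i : Fin d) : H10 Ω →L[ℂ] L2 Ω :=
  (PiLp.proj 2 (fun _ : Fin d => L2 Ω) i).comp
    ((WithLp.sndL 2 ℂ (L2 Ω) (PiLp 2 (fun _ : Fin d => L2 Ω))).comp (H10 Ω).subtypeL)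

/-- The second partial derivative `∂ᵢ∂ⱼ : H₀²(Ω) → L²(Ω)`. -/
def deriv2L (i j : Fin d) : H20 Ω →L[ℂ] L2 Ω :=
  (PiLp.proj 2 (fun _ : Fin d × Fin d => L2 Ω) (i, j)).comp
    ((WithLp.sndL 2 ℂ (Jet1 Ω) (PiLp 2 (fun _ : Fin d × Fin d => L2 Ω))).comp (H20 Ω).subtypeL)

/-- The map `((u, ∇u), D²u) ↦ (∂ᵢu, ∇∂ᵢu)` on jets. -/
def jetDeriv (i : Fin d) : Jet2 Ω →L[ℂ] Jet1 Ω :=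
  (WithLp.prodContinuousLinearEquiv 2 ℂ (L2 Ω) (PiLp 2 (fun _ : Fin d => L2 Ω))).symm.toContinuousLinearMap.comp
    (((PiLp.proj 2 (fun _ : Fin d => L2 Ω) i).comp
      ((WithLp.sndL 2 ℂ (L2 Ω) (PiLp 2 (fun _ : Fin d => L2 Ω))).comp (jetFst Ω))).prod
    ((PiLp.continuousLinearEquiv 2 ℂ (fun _ : Fin d => L2 Ω)).symm.toContinuousLinearMap.comp
      (ContinuousLinearMap.pi fun j => (PiLp.proj 2 (fun _ : Fin d × Fin d => L2 Ω) (i, j)).comp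
        (WithLp.sndL 2 ℂ (Jet1 Ω) (PiLp 2 (fun _ : Fin d × Fin d => L2 Ω))))))

/-- For a test function this is the jet of `∂ᵢφ`, again a test function; closedness of `H₀¹` does
the rest. -/
theorem jetDeriv_mem (i : Fin d) (u : H20 Ω) : jetDeriv i u.1 ∈ H10 Ω := by
  rw [← SetLike.mem_coe, ← isClosed_H10.closure_eq]
  refine map_mem_closure (jetDeriv i).continuous (mem_closure_testJet2 u) ?_
  rintro _ ⟨φ, rfl⟩
  exact testJet1_mem_H10 (testDeriv i φ)

/-- The partial derivative `∂ᵢ : H₀²(Ω) → H₀¹(Ω)`. -/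
def derivH20 (i : Fin d) : H20 Ω →L[ℂ] H10 Ω :=
  ((jetDeriv i).comp (H20 Ω).subtypeL).codRestrict (H10 Ω) (jetDeriv_mem i)

/-! ### The Poincaré inequality -/

theorem norm_toL2_le {R : ℝ} (hR : 0 ≤ R) (hΩ : ∀ x ∈ Ω, ∀ y ∈ Ω, dist x y < R) (i : Fin d)
    (u : H10 Ω) : ‖H10.toL2 Ω u‖ ≤ R * ‖H10.deriv u i‖ := by
  refine denseRange_testH10.induction_on u (p := fun u => ‖H10.toL2 Ω u‖ ≤ R * ‖derivL i u‖)
    (isClosed_le (by fun_prop) (by fun_prop)) fun φ => ?_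
  exact norm_testL2_le hR hΩ i φ

/-- The second derivatives control the norm of `H₀²(Ω)`. -/
theorem exists_norm_sq_H20_le [NeZero d] (hΩ : Bornology.IsBounded (Ω : Set (E d))) :
    ∃ C : ℝ, 0 < C ∧ ∀ u : H20 Ω,
      ‖u‖ ^ 2 ≤ C * ∑ p : Fin d × Fin d, ‖H20.deriv2 u p.1 p.2‖ ^ 2 := by
  obtain ⟨R, hR0, hR⟩ : ∃ R : ℝ, 0 ≤ R ∧ ∀ x ∈ Ω, ∀ y ∈ Ω, dist x y < R :=
    ⟨Metric.diam (Ω : Set (E d)) + 1, by positivity, fun x hx y hy =>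
      (Metric.dist_le_diam_of_mem hΩ hx hy).trans_lt (lt_add_one _)⟩
  -- Poincaré for `u` gives `R ^ 2 + 1` times the gradient term, Poincaré for `∂ᵢu` the factor `R ^
  -- 2`; the last `1` is the Hessian term itself.
  refine ⟨(R ^ 2 + 1) * R ^ 2 + 1, by positivity, fun u => ?_⟩
  have h1 : ‖H10.toL2 Ω (H20.toH10 Ω u)‖ ^ 2 ≤
      R ^ 2 * ∑ i, ‖H10.deriv (H20.toH10 Ω u) i‖ ^ 2 := by
    calc _ ≤ (R * ‖H10.deriv (H20.toH10 Ω u) 0‖) ^ 2 := by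
          gcongr
          exact norm_toL2_le hR0 hR 0 _
      _ = R ^ 2 * ‖H10.deriv (H20.toH10 Ω u) 0‖ ^ 2 := mul_pow _ _ _
      _ ≤ _ := by
          gcongr
          exact Finset.single_le_sum (f := fun i => ‖H10.deriv (H20.toH10 Ω u) i‖ ^ 2)
            (fun i _ => by positivity) (Finset.mem_univ 0)
  have h2 : ∑ i, ‖H10.deriv (H20.toH10 Ω u) i‖ ^ 2 ≤
      R ^ 2 * ∑ p : Fin d × Fin d, ‖H20.deriv2 u p.1 p.2‖ ^ 2 := by
    rw [Fintype.sum_prod_type, Finset.mul_sum]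
    refine Finset.sum_le_sum fun i _ => ?_
    calc _ ≤ (R * ‖H20.deriv2 u i 0‖) ^ 2 := by
          gcongr
          exact norm_toL2_le hR0 hR 0 (derivH20 i u)
      _ = R ^ 2 * ‖H20.deriv2 u i 0‖ ^ 2 := mul_pow _ _ _
      _ ≤ _ := by
          gcongr
          exact Finset.single_le_sum (f := fun j => ‖H20.deriv2 u i j‖ ^ 2)
            (fun i _ => by positivity) (Finset.mem_univ 0)
  rw [norm_sq_H20, norm_sq_H10]
  nlinarith [mul_le_mul_of_nonneg_left h2 (sq_nonneg R)]

/-! ### Compactness of the inclusions -/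

theorem isCompactOperator_of_approx {X Y : Type*} [NormedAddCommGroup X] [NormedSpace ℂ X]
    [NormedAddCommGroup Y] [NormedSpace ℂ Y] [CompleteSpace Y] {J : X →L[ℂ] Y}
    (h : ∀ ε : ℝ, 0 < ε → ∃ S : X →L[ℂ] Y, IsCompactOperator S ∧ ‖J - S‖ ≤ ε) :
    IsCompactOperator J := by
  choose! S hS hS' using fun n : ℕ => h (1 / ((n : ℝ) + 1)) (by positivity)
  refine isCompactOperator_of_tendsto (l := Filter.atTop) (F := S) ?_ (.of_forall hS)
  refine tendsto_iff_norm_sub_tendsto_zero.2 ?_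
  exact squeeze_zero (fun _ => norm_nonneg _) (fun n => (norm_sub_rev _ _).trans_le (hS' n))
    tendsto_one_div_add_atTop_nhds_zero_nat

theorem exists_compact_approx_toL2 (hΩ : Bornology.IsBounded (Ω : Set (E d))) {h : ℝ}
    (hh : 0 < h) : ∃ S : H10 Ω →L[ℂ] L2 Ω, IsCompactOperator S ∧
      ‖H10.toL2 Ω - S‖ ≤ h * (2 ^ d * d) := by
  obtain ⟨P, hP, hP'⟩ := exists_compact_approx hΩ hh
  refine ⟨P.comp (H10.toL2 Ω), hP.comp_clm _, ContinuousLinearMap.opNorm_le_bound _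
    (by positivity) fun u => ?_⟩
  refine denseRange_testH10.induction_on u
    (p := fun u => ‖(H10.toL2 Ω - P.comp (H10.toL2 Ω)) u‖ ≤ h * (2 ^ d * d) * ‖u‖)
    (isClosed_le (by fun_prop) (by fun_prop)) fun φ => ?_
  refine norm_le_of_enorm_sq_le (by positivity) ((hP' φ).trans ?_)
  have h1 : ∑ i, ‖testL2 (testDeriv i φ)‖ₑ ^ 2 ≤ ‖testH10 φ‖ₑ ^ 2 := by
    simp only [← ofReal_norm, ← ENNReal.ofReal_pow (norm_nonneg _)]
    rw [← ENNReal.ofReal_sum_of_nonneg fun i _ => by positivity]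
    refine ENNReal.ofReal_le_ofReal ?_
    rw [norm_sq_H10]
    exact le_add_of_nonneg_left (by positivity)
  -- Replacing `2ᵈd` by its square avoids a square root in the constant.
  have h2 : (2 ^ d * d : ℝ≥0∞) ≤ (2 ^ d * d) ^ 2 := by
    exact_mod_cast Nat.le_self_pow two_ne_zero (2 ^ d * d)
  have h3 : ENNReal.ofReal (h * (2 ^ d * d)) = ENNReal.ofReal h * (2 ^ d * d) := by
    rw [ENNReal.ofReal_mul hh.le, ENNReal.ofReal_mul (by positivity),
      ENNReal.ofReal_pow zero_le_two, ENNReal.ofReal_natCast, ENNReal.ofReal_ofNat]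
  calc 2 ^ d * (ENNReal.ofReal h ^ 2 * (d * ∑ i, ‖testL2 (testDeriv i φ)‖ₑ ^ 2))
      = ENNReal.ofReal h ^ 2 * (2 ^ d * d) * ∑ i, ‖testL2 (testDeriv i φ)‖ₑ ^ 2 := by ring
    _ ≤ ENNReal.ofReal h ^ 2 * (2 ^ d * d) ^ 2 * ‖testH10 φ‖ₑ ^ 2 := by gcongr
    _ = _ := by rw [h3, mul_pow (ENNReal.ofReal h)]

/-- The Rellich theorem: the inclusion `H₀¹(Ω) → L²(Ω)` is compact for bounded `Ω`. -/
theorem isCompactOperator_toL2 (hΩ : Bornology.IsBounded (Ω : Set (E d))) :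
    IsCompactOperator (H10.toL2 Ω) := by
  refine isCompactOperator_of_approx fun ε hε => ?_
  obtain ⟨S, hS, hS'⟩ := exists_compact_approx_toL2 hΩ (h := ε / (2 ^ d * d + 1))
    (by positivity)
  refine ⟨S, hS, hS'.trans ?_⟩
  rw [div_mul_eq_mul_div, div_le_iff₀ (by positivity)]
  gcongr
  exact (lt_add_one _).le

/-- The adjoint of a compact operator between Hilbert spaces is compact. -/
theorem isCompactOperator_adjoint {F G : Type*} [NormedAddCommGroup F] [InnerProductSpace ℂ F]
    [CompleteSpace F] [NormedAddCommGroup G] [InnerProductSpace ℂ G] [CompleteSpace G]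
    {J : F →L[ℂ] G} (hJ : IsCompactOperator J) :
    IsCompactOperator (ContinuousLinearMap.adjoint J) := by
  set A := ContinuousLinearMap.adjoint J
  have hJA : IsCompactOperator (J.comp A) := hJ.comp_clm A
  refine (isCompactOperator_iff_isCompact_closure_image_closedBall (A : G →ₗ[ℂ] F) zero_lt_one).2 ?_
  have htb : TotallyBounded ((J.comp A) '' Metric.closedBall 0 1) :=
    ((isCompactOperator_iff_isCompact_closure_image_closedBall
      ((J.comp A : G →L[ℂ] G) : G →ₗ[ℂ] G) zero_lt_one).1 hJA).totallyBounded.subset subset_closure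
  refine TotallyBounded.isCompact_of_isClosed (TotallyBounded.closure ?_) isClosed_closure
  refine Metric.totallyBounded_iff.2 fun ε hε => ?_
  -- With `‖x - g y‖ ≤ 2`, the inequality `‖A w‖² ≤ ‖J A w‖ ‖w‖` turns precision `ε²/4` for `J A`
  -- into `ε` for `A`.
  obtain ⟨t, hts, htf, ht⟩ := Metric.finite_approx_of_totallyBounded htb (ε ^ 2 / 4) (by positivity)
  have hts' : ∀ y ∈ t, ∃ x ∈ Metric.closedBall (0 : G) 1, (J.comp A) x = y := fun y hy => hts hy
  choose! g hg hg' using hts'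
  refine ⟨(fun y => A (g y)) '' t, htf.image _, ?_⟩
  rintro _ ⟨x, hx, rfl⟩
  obtain ⟨y, hy, hxy⟩ := Set.mem_iUnion₂.1 (ht ⟨x, hx, rfl⟩)
  refine Set.mem_iUnion₂.2 ⟨A (g y), ⟨y, hy, rfl⟩, ?_⟩
  rw [Metric.mem_ball, dist_eq_norm] at hxy ⊢
  rw [← hg' y hy, ← map_sub] at hxy
  have hd : ‖x - g y‖ ≤ 2 := by
    have h1 := mem_closedBall_zero_iff.1 hx
    have h2 := mem_closedBall_zero_iff.1 (hg y hy)
    linarith [norm_sub_le x (g y)]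
  have hA : ‖A (x - g y)‖ ^ 2 ≤ ‖(J.comp A) (x - g y)‖ * ‖x - g y‖ := by
    calc ‖A (x - g y)‖ ^ 2 = ‖inner ℂ (A (x - g y)) (A (x - g y))‖ := by
          rw [inner_self_eq_norm_sq_to_K]; simp
      _ = ‖inner ℂ (J (A (x - g y))) (x - g y)‖ := by
          rw [ContinuousLinearMap.adjoint_inner_right]
      _ ≤ _ := norm_inner_le_norm _ _
  change ‖A x - A (g y)‖ < ε
  rw [← map_sub]
  refine lt_of_pow_lt_pow_left₀ 2 hε.le ?_
  nlinarith [mul_le_mul_of_nonneg_left hd (norm_nonneg ((J.comp A) (x - g y)))]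

/-- The identity `(z, J v) = (J* z, v)` factors the map through the compact adjoint `J*`. -/
theorem isCompactOperator_flip_innerSL {F G : Type*} [NormedAddCommGroup F] [InnerProductSpace ℂ F]
    [CompleteSpace F] [NormedAddCommGroup G] [InnerProductSpace ℂ G] [CompleteSpace G]
    {J : F →L[ℂ] G} (hJ : IsCompactOperator J) :
    IsCompactOperator ((innerSL ℂ (E := G)).comp J).flip := by
  have h : ((innerSL ℂ (E := G)).comp J).flip = (innerSL ℂ (E := F)).flip.comp
      (ContinuousLinearMap.adjoint J) := by
    ext z v
    exact (ContinuousLinearMap.adjoint_inner_right J v z).symm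
  rw [h]
  exact (isCompactOperator_adjoint hJ).clm_comp (innerSL ℂ (E := F)).flip

theorem isCompactOperator_L2toHneg1 (hΩ : Bornology.IsBounded (Ω : Set (E d))) :
    IsCompactOperator (L2toHneg1 Ω) := by
  have h := isCompactOperator_flip_innerSL (F := H10 Ω) (G := L2 Ω) (J := H10.toL2 Ω)
    (isCompactOperator_toL2 hΩ)
  unfold L2toHneg1
  exact h

/-- All components `u`, `∂ᵢu` of the first-order jet come from `H₀¹` functions, so Rellich applies
to each; the target may be restricted to `H₀¹` because it is closed. -/
theorem isCompactOperator_toH10 (hΩ : Bornology.IsBounded (Ω : Set (E d))) :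
    IsCompactOperator (H20.toH10 Ω) := by
  have hJ := isCompactOperator_toL2 hΩ
  have hd : IsCompactOperator fun u : H20 Ω => ((H10.toL2 Ω (H20.toH10 Ω u),
      fun i => H10.toL2 Ω (derivH20 i u)) : L2 Ω × (Fin d → L2 Ω)) := by
    have h1 := (hJ.comp_clm (H20.toH10 Ω)).clm_comp
      (ContinuousLinearMap.inl ℂ (L2 Ω) (Fin d → L2 Ω))
    have h2 : ∀ i, IsCompactOperator ((ContinuousLinearMap.inr ℂ (L2 Ω) (Fin d → L2 Ω)) ∘
        (ContinuousLinearMap.single ℂ (fun _ : Fin d => L2 Ω) i) ∘ H10.toL2 Ω ∘ derivH20 i) :=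
      fun i => ((hJ.comp_clm (derivH20 i)).clm_comp _).clm_comp _
    have h3 := h1.add (Submodule.sum_mem
      (compactOperator (RingHom.id ℂ) (H20 Ω) (L2 Ω × (Fin d → L2 Ω)))
      (t := Finset.univ) (f := fun i => (ContinuousLinearMap.inr ℂ (L2 Ω) (Fin d → L2 Ω)).comp
        ((ContinuousLinearMap.single ℂ (fun _ : Fin d => L2 Ω) i).comp
          ((H10.toL2 Ω).comp (derivH20 i)))) fun i _ => h2 i)
    refine Eq.subst (funext fun u => ?_) h3
    refine Prod.ext ?_ ?_
    · simp [Prod.fst_sum]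
    · simp [Prod.snd_sum, Finset.univ_sum_single]
  let L : (L2 Ω × (Fin d → L2 Ω)) →L[ℂ] Jet1 Ω :=
    (WithLp.prodContinuousLinearEquiv 2 ℂ (L2 Ω)
      (PiLp 2 (fun _ : Fin d => L2 Ω))).symm.toContinuousLinearMap.comp
    ((ContinuousLinearMap.id ℂ (L2 Ω)).prodMap
      (PiLp.continuousLinearEquiv 2 ℂ (fun _ : Fin d => L2 Ω)).symm.toContinuousLinearMap)
  exact (hd.clm_comp L).codRestrict (V := H10 Ω) (fun u => (H20.toH10 Ω u).2) isClosed_H10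

theorem isCompactOperator_incl (hΩ : Bornology.IsBounded (Ω : Set (E d))) :
    IsCompactOperator (incl Ω) := by
  have h1 := ((isCompactOperator_toH10 hΩ).comp_clm (ContinuousLinearMap.fst ℂ (H20 Ω) (L2 Ω))).clm_comp
    (ContinuousLinearMap.inl ℂ (H10 Ω) (Hneg1 Ω))
  have h2 := ((isCompactOperator_L2toHneg1 hΩ).comp_clm
    (ContinuousLinearMap.snd ℂ (H20 Ω) (L2 Ω))).clm_comp (ContinuousLinearMap.inr ℂ (H10 Ω) (Hneg1 Ω))
  refine Eq.subst (funext fun u => ?_) (h1.add h2)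
  simp [incl, Prod.map]

section Mollification

/-! ### Mollification -/

open ContinuousLinearMap (lsmul)
open scoped Convolution Topology

/-- The mollification of the extension of `u` by zero outside `Ω`. -/
def mollify (Ω : Opens (E d)) (b : ContDiffBump (0 : E d)) (u : E d → ℂ) : E d → ℂ :=
  b.normed volume ⋆[lsmul ℝ ℝ, volume] (Ω : Set (E d)).indicator u

theorem _root_.MeasureTheory.MemLp.exists_ae_norm_le {α F : Type*} [MeasurableSpace α]
    [NormedAddCommGroup F] {ν : Measure α} {u : α → F} (hu : MemLp u ∞ ν) :
    ∃ C : ℝ, ∀ᵐ x ∂ν, ‖u x‖ ≤ C := by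
  refine ⟨(eLpNormEssSup u ν).toReal, ?_⟩
  filter_upwards [ae_le_eLpNormEssSup (f := u) (μ := ν)] with x hx
  rw [← toReal_enorm]
  refine ENNReal.toReal_mono ?_ hx
  rw [← eLpNorm_exponent_top]
  exact hu.2.ne

theorem memLp_indicator {u : E d → ℂ} (hu : MemLp u ∞ (vol Ω)) :
    MemLp ((Ω : Set (E d)).indicator u) ∞ volume :=
  (memLp_indicator_iff_restrict Ω.isOpen.measurableSet).2 hu

theorem locallyIntegrable_indicator {u : E d → ℂ} (hu : MemLp u ∞ (vol Ω)) :
    LocallyIntegrable ((Ω : Set (E d)).indicator u) volume :=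
  (memLp_indicator hu).locallyIntegrable (by simp)

theorem contDiff_mollify (b : ContDiffBump (0 : E d)) {u : E d → ℂ} (hu : MemLp u ∞ (vol Ω)) :
    ContDiff ℝ ((⊤ : ℕ∞) : WithTop ℕ∞) (mollify Ω b u) :=
  b.hasCompactSupport_normed.contDiff_convolution_left _ b.contDiff_normed
    (locallyIntegrable_indicator hu)

theorem norm_mollify_le (b : ContDiffBump (0 : E d)) {u : E d → ℂ} {C : ℝ}
    (hC : ∀ᵐ x, ‖(Ω : Set (E d)).indicator u x‖ ≤ C) (x : E d) : ‖mollify Ω b u x‖ ≤ C := by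
  rw [mollify, convolution_def]
  have hae : ∀ᵐ t, ‖(Ω : Set (E d)).indicator u (x - t)‖ ≤ C :=
    (quasiMeasurePreserving_sub_left volume x).ae hC
  calc _ ≤ ∫ t, b.normed volume t * C := by
        refine norm_integral_le_of_norm_le (b.integrable_normed.mul_const C) ?_
        filter_upwards [hae] with t ht
        rw [ContinuousLinearMap.lsmul_apply, norm_smul, Real.norm_of_nonneg (b.nonneg_normed t)]
        exact mul_le_mul_of_nonneg_left ht (b.nonneg_normed t)
    _ = C := by rw [integral_mul_const, b.integral_normed, one_mul]

/-- Mollification commutes with weak derivatives away from the boundary. -/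
theorem fderiv_mollify {b : ContDiffBump (0 : E d)} {i : Fin d} {u g : E d → ℂ}
    (hu : MemLp u ∞ (vol Ω)) (hg : IsWeakDeriv Ω i u g) {x : E d}
    (hx : Metric.closedBall x b.rOut ⊆ Ω) :
    fderiv ℝ (mollify Ω b u) x (e i) = mollify Ω b g x := by
  set f := b.normed (volume : Measure (E d))
  have hf : ContDiff ℝ ((⊤ : ℕ∞) : WithTop ℕ∞) f := b.contDiff_normed
  have hloc := locallyIntegrable_indicator hu
  have h1 : fderiv ℝ (mollify Ω b u) x (e i) =
      ∫ t, (fderiv ℝ f (x - t) (e i)) • (Ω : Set (E d)).indicator u t := by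
    have h := b.hasCompactSupport_normed.hasFDerivAt_convolution_left (μ := volume)
      (lsmul ℝ ℝ : ℝ →L[ℝ] ℂ →L[ℝ] ℂ) (hf.of_le (by exact_mod_cast le_top)) hloc x
    have hex := (b.hasCompactSupport_normed.fderiv ℝ).convolutionExists_left (μ := volume)
      ((lsmul ℝ ℝ : ℝ →L[ℝ] ℂ →L[ℝ] ℂ).precompL (E d)) (hf.continuous_fderiv (by simp)) hloc x
    rw [mollify, h.fderiv, convolution_def, ContinuousLinearMap.integral_apply hex]
    exact convolution_lsmul_swap (f := fun t => fderiv ℝ f t (e i))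
  -- The reflected, translated kernel is supported in the closed ball about `x`, hence is an
  -- admissible test function in the definition of the weak derivative.
  let ψ : 𝓓(Ω, ℂ) :=
    { toFun := fun t => (f (x - t) : ℂ)
      contDiff' := Complex.ofRealCLM.contDiff.comp (hf.comp (contDiff_const.sub contDiff_id))
      hasCompactSupport' := by
        refine HasCompactSupport.intro (isCompact_closedBall x b.rOut) fun t ht => ?_
        have : f (x - t) = 0 := by
          rw [← Function.notMem_support, b.support_normed_eq]
          simp only [Metric.mem_closedBall, not_le, Metric.mem_ball, dist_zero_right, not_lt] at ht ⊢
          rw [← dist_eq_norm, dist_comm]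
          exact ht.le
        rw [this, Complex.ofReal_zero]
      tsupport_subset' := by
        refine (closure_minimal (fun t ht => ?_) Metric.isClosed_closedBall).trans hx
        by_contra h
        refine ht ?_
        have : f (x - t) = 0 := by
          rw [← Function.notMem_support, b.support_normed_eq]
          simp only [Metric.mem_closedBall, not_le, Metric.mem_ball, dist_zero_right, not_lt] at h ⊢
          rw [← dist_eq_norm, dist_comm]
          exact h.le
        change (f (x - t) : ℂ) = 0
        rw [this, Complex.ofReal_zero] }
  have h2 : ∀ t, testDeriv i ψ t = -(fderiv ℝ f (x - t) (e i) : ℂ) := by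
    intro t
    have hd : HasFDerivAt (fun t => (f (x - t) : ℂ))
        (Complex.ofRealCLM.comp ((fderiv ℝ f (x - t)).comp (-ContinuousLinearMap.id ℝ (E d)))) t := by
      have h3 : HasFDerivAt (fun t => x - t) (-ContinuousLinearMap.id ℝ (E d)) t :=
        (hasFDerivAt_id t).const_sub x
      exact Complex.ofRealCLM.hasFDerivAt.comp t
        (((hf.differentiable (by simp)) (x - t)).hasFDerivAt.comp t h3)
    change fderiv ℝ (fun t => (f (x - t) : ℂ)) t (e i) = _
    rw [hd.fderiv]
    simp
  rw [h1, mollify, convolution_lsmul_swap]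
  have h4 := hg ψ
  have h5 : ∀ (w : E d → ℂ) (c : E d → ℝ), ∫ t, c t • (Ω : Set (E d)).indicator w t =
      ∫ t in (Ω : Set (E d)), w t * (c t : ℂ) := by
    intro w c
    rw [← integral_indicator Ω.isOpen.measurableSet]
    congr 1
    ext t
    by_cases ht : t ∈ (Ω : Set (E d))
    · rw [Set.indicator_of_mem ht, Set.indicator_of_mem ht, Complex.real_smul, mul_comm]
    · rw [Set.indicator_of_notMem ht, Set.indicator_of_notMem ht, smul_zero]
  rw [h5, h5]
  simp only [h2, mul_neg] at h4
  rw [integral_neg, neg_inj] at h4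
  exact h4

/-- The product of a smooth function and a test function. -/
def smoothMul (q : E d → ℂ) (hq : ContDiff ℝ ((⊤ : ℕ∞) : WithTop ℕ∞) q) (φ : 𝓓(Ω, ℂ)) :
    𝓓(Ω, ℂ) where
  toFun x := q x * φ x
  contDiff' := hq.mul φ.contDiff
  hasCompactSupport' := φ.hasCompactSupport.mul_left
  tsupport_subset' := (tsupport_mul_subset_right).trans φ.tsupport_subset

/-- A sequence of bump functions shrinking to the origin. -/
def bump (d k : ℕ) : ContDiffBump (0 : E d) where
  -- The fixed ratio `rOut = 2 rIn` is what almost everywhere convergence of the mollifications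
  -- requires.
  rIn := 1 / ((k : ℝ) + 1) / 2
  rOut := 1 / ((k : ℝ) + 1)
  rIn_pos := by positivity
  rIn_lt_rOut := half_lt_self (by positivity)

theorem tendsto_bump_rOut : Filter.Tendsto (fun k => (bump d k).rOut) Filter.atTop (𝓝 0) :=
  tendsto_one_div_add_atTop_nhds_zero_nat

/-- For merely bounded `u`, mollifications converge almost everywhere and stay below the same bound;
dominated convergence with majorant `(2C)² |φ|²` gives the `L²` limit. -/
theorem tendsto_testL2_mollify_mul {u : E d → ℂ} (hu : MemLp u ∞ (vol Ω)) (φ : 𝓓(Ω, ℂ)) :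
    Filter.Tendsto (fun k => testL2 (smoothMul (mollify Ω (bump d k) u) (contDiff_mollify _ hu) φ))
      Filter.atTop (𝓝 (mulL2 hu (testL2 φ))) := by
  obtain ⟨C, hC⟩ : ∃ C : ℝ, ∀ᵐ x, ‖(Ω : Set (E d)).indicator u x‖ ≤ C :=
    (memLp_indicator hu).exists_ae_norm_le
  have hlim : ∀ᵐ x ∂(vol Ω), Filter.Tendsto (fun k => mollify Ω (bump d k) u x) Filter.atTop
      (𝓝 (u x)) := by
    have h := ContDiffBump.ae_convolution_tendsto_right_of_locallyIntegrable (K := 2)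
      (tendsto_bump_rOut (d := d)) (.of_forall fun k => by simp only [bump]; linarith)
      (locallyIntegrable_indicator hu)
    filter_upwards [ae_restrict_of_ae h, ae_restrict_mem Ω.isOpen.measurableSet] with x hx hx'
    rw [Set.indicator_of_mem hx'] at hx
    exact hx
  have hCu : ∀ᵐ x ∂(vol Ω), ‖u x‖ ≤ C := by
    filter_upwards [ae_restrict_of_ae hC, ae_restrict_mem Ω.isOpen.measurableSet] with x hx hx'
    rwa [Set.indicator_of_mem hx'] at hx
  have hval : ∀ k, ‖testL2 (smoothMul (mollify Ω (bump d k) u) (contDiff_mollify _ hu) φ) -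
      mulL2 hu (testL2 φ)‖ₑ ^ 2 =
      ∫⁻ x, ‖(mollify Ω (bump d k) u x - u x) * φ x‖ₑ ^ 2 ∂(vol Ω) := by
    intro k
    rw [enorm_L2_sq]
    refine lintegral_congr_ae ?_
    filter_upwards [Lp.coeFn_sub (testL2 (smoothMul (mollify Ω (bump d k) u)
      (contDiff_mollify _ hu) φ)) (mulL2 hu (testL2 φ)), coeFn_mulL2 hu (testL2 φ),
      (memLp_test φ).coeFn_toLp, (memLp_test (smoothMul (mollify Ω (bump d k) u)
      (contDiff_mollify _ hu) φ)).coeFn_toLp] with x h1 h2 h3 h4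
    have h4' : testL2 (smoothMul (mollify Ω (bump d k) u) (contDiff_mollify _ hu) φ) x =
      mollify Ω (bump d k) u x * φ x := h4
    have h3' : testL2 φ x = φ x := h3
    rw [h1, Pi.sub_apply, h2, h4', h3', sub_mul]
  have hmain : Filter.Tendsto (fun k => ∫⁻ x, ‖(mollify Ω (bump d k) u x - u x) * φ x‖ₑ ^ 2 ∂(vol Ω))
      Filter.atTop (𝓝 (∫⁻ _x, 0 ∂(vol Ω))) := by
    refine tendsto_lintegral_of_dominated_convergence'
      (fun x => ENNReal.ofReal (2 * C) ^ 2 * ‖φ x‖ₑ ^ 2) (fun k => ?_) (fun k => ?_) ?_ ?_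
    · have hm := ((contDiff_mollify (bump d k) hu).continuous.aestronglyMeasurable
        (μ := vol Ω)).sub hu.aestronglyMeasurable
      exact ((hm.mul φ.continuous.aestronglyMeasurable).enorm).pow_const 2
    · filter_upwards [hCu] with x hx
      rw [enorm_mul, mul_pow]
      gcongr
      rw [← ofReal_norm]
      refine ENNReal.ofReal_le_ofReal ((norm_sub_le _ _).trans ?_)
      linarith [norm_mollify_le (bump d k) hC x]
    · rw [lintegral_const_mul' _ _ (ENNReal.pow_ne_top ENNReal.ofReal_ne_top)]
      refine ENNReal.mul_ne_top (ENNReal.pow_ne_top ENNReal.ofReal_ne_top) (ne_top_of_le_ne_top ?_ (setLIntegral_le_lintegral _ _))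
      rw [← enorm_testL2_sq]
      exact ENNReal.pow_ne_top enorm_ne_top
    · filter_upwards [hlim] with x hx
      have h1 : Filter.Tendsto (fun k => (mollify Ω (bump d k) u x - u x) * φ x) Filter.atTop
          (𝓝 ((u x - u x) * φ x)) := (hx.sub_const _).mul_const _
      have h2 := ((ENNReal.continuous_pow 2).tendsto _).comp h1.enorm
      simpa [Function.comp_def] using h2
  rw [lintegral_zero] at hmain
  simp only [← hval] at hmain
  rw [tendsto_iff_norm_sub_tendsto_zero]
  have h3 := (ENNReal.tendsto_toReal (by simp)).comp hmain
  simp only [Function.comp_def, ENNReal.toReal_pow, toReal_enorm, ENNReal.toReal_zero] at h3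
  have h4 := h3.sqrt
  simpa using h4

end Mollification

section Multipliers

/-! ### Multiplication operators on `H₀¹(Ω)` -/

open scoped Topology

/-- The Leibniz rule on jets: `(u, ∇u) ↦ (qu, q∇u + ug)`, where `g = ∇q`. -/
def mulJet {q : E d → ℂ} {g : Fin d → E d → ℂ} (hq : MemLp q ∞ (vol Ω))
    (hg : ∀ i, MemLp (g i) ∞ (vol Ω)) : Jet1 Ω →L[ℂ] Jet1 Ω :=
  (WithLp.prodContinuousLinearEquiv 2 ℂ (L2 Ω)
    (PiLp 2 (fun _ : Fin d => L2 Ω))).symm.toContinuousLinearMap.comp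
  (((mulL2 hq).comp (WithLp.fstL 2 ℂ (L2 Ω) (PiLp 2 (fun _ : Fin d => L2 Ω)))).prod
    ((PiLp.continuousLinearEquiv 2 ℂ (fun _ : Fin d => L2 Ω)).symm.toContinuousLinearMap.comp
      (ContinuousLinearMap.pi fun i =>
        (mulL2 hq).comp ((PiLp.proj 2 (fun _ : Fin d => L2 Ω) i).comp
          (WithLp.sndL 2 ℂ (L2 Ω) (PiLp 2 (fun _ : Fin d => L2 Ω)))) +
        (mulL2 (hg i)).comp (WithLp.fstL 2 ℂ (L2 Ω) (PiLp 2 (fun _ : Fin d => L2 Ω))))))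

theorem testDeriv_smoothMul {q : E d → ℂ} (hq : ContDiff ℝ ((⊤ : ℕ∞) : WithTop ℕ∞) q)
    (φ : 𝓓(Ω, ℂ)) (i : Fin d) (x : E d) :
    testDeriv i (smoothMul q hq φ) x = fderiv ℝ q x (e i) * φ x + q x * testDeriv i φ x := by
  have h1 := (hq.differentiable (by simp)) x
  have h2 := (φ.contDiff.differentiable (by simp)) x
  change fderiv ℝ (q * ⇑φ) x (e i) = _
  rw [fderiv_mul h1 h2]
  change q x • fderiv ℝ φ x (e i) + φ x • fderiv ℝ q x (e i) = _ + q x * fderiv ℝ φ x (e i)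
  simp only [smul_eq_mul]
  ring

/-- The support of `φ` has a closed neighbourhood inside `Ω`. Once the mollification radius is small
enough the derivatives agree on that support, and elsewhere `φ` vanishes. -/
theorem eventually_fderiv_mollify_mul {u g : E d → ℂ} {i : Fin d} (hu : MemLp u ∞ (vol Ω))
    (hg : IsWeakDeriv Ω i u g) (φ : 𝓓(Ω, ℂ)) : ∀ᶠ k in Filter.atTop, ∀ x,
      fderiv ℝ (mollify Ω (bump d k) u) x (e i) * φ x = mollify Ω (bump d k) g x * φ x := by
  obtain ⟨δ, hδ, hδ'⟩ := φ.hasCompactSupport.isCompact.exists_cthickening_subset_open Ω.isOpen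
    φ.tsupport_subset
  filter_upwards [(tendsto_bump_rOut (d := d)).eventually (eventually_le_nhds hδ)] with k hk x
  by_cases hx : x ∈ tsupport φ
  · rw [fderiv_mollify hu hg]
    exact (Metric.closedBall_subset_closedBall hk).trans
      ((Metric.closedBall_subset_cthickening hx δ).trans hδ')
  · rw [image_eq_zero_of_notMem_tsupport hx, mul_zero, mul_zero]

/-- The products of `φ` with mollifications of `q` are test functions whose jets converge to the
Leibniz jet. -/
theorem mulJet_test_mem {q : E d → ℂ} {g : Fin d → E d → ℂ} (hq : MemLp q ∞ (vol Ω))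
    (hg : ∀ i, MemLp (g i) ∞ (vol Ω)) (hqg : ∀ i, IsWeakDeriv Ω i q (g i)) (φ : 𝓓(Ω, ℂ)) :
    mulJet hq hg (testJet1 φ) ∈ H10 Ω := by
  let θ : ℕ → 𝓓(Ω, ℂ) := fun k => smoothMul (mollify Ω (bump d k) q) (contDiff_mollify _ hq) φ
  have hθ : Filter.Tendsto (fun k => testL2 (θ k)) Filter.atTop (𝓝 (mulL2 hq (testL2 φ))) :=
    tendsto_testL2_mollify_mul hq φ
  have hθ' : ∀ i, Filter.Tendsto (fun k => testL2 (testDeriv i (θ k))) Filter.atTop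
      (𝓝 (mulL2 hq (testL2 (testDeriv i φ)) + mulL2 (hg i) (testL2 φ))) := by
    intro i
    refine ((tendsto_testL2_mollify_mul hq (testDeriv i φ)).add
      (tendsto_testL2_mollify_mul (hg i) φ)).congr' ?_
    filter_upwards [eventually_fderiv_mollify_mul hq (hqg i) φ] with k hk
    rw [← testL2_add]
    congr 1
    ext x
    rw [testDeriv_smoothMul, hk x, add_comm]
    rfl
  refine isClosed_H10.mem_of_tendsto (f := fun k => testJet1 (θ k)) (b := Filter.atTop) ?_
    (.of_forall fun k => testJet1_mem_H10 _)
  have h1 : Filter.Tendsto (fun k => ((testL2 (θ k), fun i => testL2 (testDeriv i (θ k))) :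
      L2 Ω × (Fin d → L2 Ω))) Filter.atTop (𝓝 (mulL2 hq (testL2 φ), fun i =>
        mulL2 hq (testL2 (testDeriv i φ)) + mulL2 (hg i) (testL2 φ))) :=
    hθ.prodMk_nhds (tendsto_pi_nhds.2 hθ')
  let L : (L2 Ω × (Fin d → L2 Ω)) →L[ℂ] Jet1 Ω :=
    (WithLp.prodContinuousLinearEquiv 2 ℂ (L2 Ω)
      (PiLp 2 (fun _ : Fin d => L2 Ω))).symm.toContinuousLinearMap.comp
    ((ContinuousLinearMap.id ℂ (L2 Ω)).prodMap
      (PiLp.continuousLinearEquiv 2 ℂ (fun _ : Fin d => L2 Ω)).symm.toContinuousLinearMap)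
  exact (L.continuous.tendsto _).comp h1

/-- Multiplication by a function in `W^{1,∞}(Ω)` maps `H₀¹(Ω)` to itself. -/
theorem exists_mulH10 {q : E d → ℂ} {g : Fin d → E d → ℂ} (hq : MemLp q ∞ (vol Ω))
    (hg : ∀ i, MemLp (g i) ∞ (vol Ω)) (hqg : ∀ i, IsWeakDeriv Ω i q (g i)) :
    ∃ M : H10 Ω →L[ℂ] H10 Ω, ∀ u, H10.toL2 Ω (M u) = mulL2 hq (H10.toL2 Ω u) ∧
      ∀ i, H10.deriv (M u) i = mulL2 hq (H10.deriv u i) + mulL2 (hg i) (H10.toL2 Ω u) :=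
  ⟨((mulJet hq hg).comp (H10 Ω).subtypeL).codRestrict (H10 Ω)
    (mem_H10_of_test _ (mulJet_test_mem hq hg hqg)), fun _ => ⟨rfl, fun _ => rfl⟩⟩

theorem norm_toL2_le_norm (u : H10 Ω) : ‖H10.toL2 Ω u‖ ≤ ‖u‖ := by
  refine le_of_sq_le_sq ?_ (norm_nonneg _)
  rw [norm_sq_H10]
  exact le_add_of_nonneg_right (by positivity)

theorem norm_deriv_le_norm (u : H10 Ω) (i : Fin d) : ‖H10.deriv u i‖ ≤ ‖u‖ := by
  refine le_of_sq_le_sq ?_ (norm_nonneg _)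
  rw [norm_sq_H10]
  exact (Finset.single_le_sum (f := fun i => ‖H10.deriv u i‖ ^ 2)
    (fun i _ => by positivity) (Finset.mem_univ i)).trans (le_add_of_nonneg_left (by positivity))

theorem norm_H10_le (u : H10 Ω) : ‖u‖ ≤ ‖H10.toL2 Ω u‖ + ∑ i, ‖H10.deriv u i‖ := by
  refine le_of_sq_le_sq ?_ (by positivity)
  have h : ∑ i, ‖H10.deriv u i‖ ^ 2 ≤ (∑ i, ‖H10.deriv u i‖) ^ 2 :=
    Finset.sum_sq_le_sq_sum_of_nonneg fun i _ => norm_nonneg _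
  have h' : 0 ≤ ∑ i, ‖H10.deriv u i‖ := by positivity
  rw [norm_sq_H10]
  nlinarith [mul_nonneg (norm_nonneg (H10.toL2 Ω u)) h']

/-- The Neumann series for a map which contracts an equivalent norm `N`. -/
theorem exists_inverse_of_contraction {X : Type*} [NormedAddCommGroup X] [NormedSpace ℂ X]
    [CompleteSpace X] (M : X →L[ℂ] X) {N : X → ℝ} {C θ : ℝ} (hθ : 0 ≤ θ) (hθ' : θ < 1)
    (hC : 0 ≤ C) (h1 : ∀ u, ‖u‖ ≤ N u) (h2 : ∀ u, N u ≤ C * ‖u‖)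
    (h3 : ∀ u, N (M u) ≤ θ * N u) : ∃ P : X →L[ℂ] X, ∀ u, P u - M (P u) = u := by
  suffices hs : Summable (M ^ ·) from
    ⟨∑' k, M ^ k, fun u => congrArg (fun S : X →L[ℂ] X => S u) hs.one_sub_mul_tsum_pow⟩
  refine Summable.of_norm_bounded (g := fun k => C * θ ^ k)
    ((summable_geometric_of_lt_one hθ hθ').mul_left C) fun k => ?_
  refine ContinuousLinearMap.opNorm_le_bound _ (by positivity) fun u => ?_
  have h : ∀ k : ℕ, N ((M ^ k) u) ≤ θ ^ k * N u := by
    intro k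
    induction k with
    | zero => simp
    | succ k ih =>
      rw [pow_succ', mul_apply_eq_comp]
      calc _ ≤ θ * N ((M ^ k) u) := h3 _
        _ ≤ θ * (θ ^ k * N u) := by gcongr
        _ = _ := by ring
  calc _ ≤ θ ^ k * N u := (h1 _).trans (h k)
    _ ≤ θ ^ k * (C * ‖u‖) := by gcongr; exact h2 u
    _ = _ := by ring

/-- If `r ∈ W^{1,∞}(Ω)` and `‖r‖ ≤ ρ < 1`, then `1/(1 - r)` is a multiplier of `H₀¹(Ω)`
(Neumann series). -/
theorem exists_inverse_one_sub {r : E d → ℂ} {g : Fin d → E d → ℂ} (hr : MemLp r ∞ (vol Ω))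
    (hg : ∀ i, MemLp (g i) ∞ (vol Ω)) (hrg : ∀ i, IsWeakDeriv Ω i r (g i)) {ρ : ℝ} (hρ0 : 0 ≤ ρ)
    (hρ1 : ρ < 1) (hρ : ∀ᵐ x ∂(vol Ω), ‖r x‖ ≤ ρ) :
    ∃ P : H10 Ω →L[ℂ] H10 Ω, ∀ u, H10.toL2 Ω (P u) - mulL2 hr (H10.toL2 Ω (P u)) =
      H10.toL2 Ω u := by
  obtain ⟨M, hM⟩ := exists_mulH10 hr hg hrg
  choose C hC using fun i => (hg i).exists_ae_norm_le
  let C' : ℝ := ∑ i, |C i|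
  -- Multiplication by `r` costs an extra `C' ‖u‖₀` in the gradient, so it need not contract the
  -- `H¹` norm. Weighting `‖u‖₀` by `κ` with `C' ≤ κ (θ - ρ)` absorbs this term and gives
  -- contraction factor `θ`, strictly between `ρ` and `1`.
  let θ : ℝ := (1 + ρ) / 2
  have hθρ : 0 < θ - ρ := by simp only [θ]; linarith
  let κ : ℝ := C' / (θ - ρ) + 1
  have hC' : 0 ≤ C' := by positivity
  have hκ : 1 ≤ κ := le_add_of_nonneg_left (by positivity)
  have hκ' : C' ≤ κ * (θ - ρ) := by
    simp only [κ, add_mul, div_mul_cancel₀ _ hθρ.ne']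
    linarith
  let N : H10 Ω → ℝ := fun u => κ * ‖H10.toL2 Ω u‖ + ∑ i, ‖H10.deriv u i‖
  have hs : ∃ P : H10 Ω →L[ℂ] H10 Ω, ∀ u, P u - M (P u) = u := by
    refine exists_inverse_of_contraction M (N := N) (C := κ + d) (θ := θ)
      (by linarith) (by simp only [θ]; linarith) (by positivity) (fun u => ?_) (fun u => ?_)
      (fun u => ?_)
    · refine (norm_H10_le u).trans ?_
      simp only [N]
      gcongr
      exact le_mul_of_one_le_left (norm_nonneg _) hκ
    · have h1 : ∑ i, ‖H10.deriv u i‖ ≤ d * ‖u‖ := by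
        refine (Finset.sum_le_card_nsmul _ _ ‖u‖ fun i _ => norm_deriv_le_norm u i).trans ?_
        simp
      have h2 := mul_le_mul_of_nonneg_left (norm_toL2_le_norm u) (zero_le_one.trans hκ)
      simp only [N]
      linarith
    · have h1 : ‖H10.toL2 Ω (M u)‖ ≤ ρ * ‖H10.toL2 Ω u‖ := by
        rw [(hM u).1]
        exact norm_mulL2_le hr hρ _
      have h2 : ∑ i, ‖H10.deriv (M u) i‖ ≤
          ρ * ∑ i, ‖H10.deriv u i‖ + C' * ‖H10.toL2 Ω u‖ := by
        rw [Finset.mul_sum, Finset.sum_mul, ← Finset.sum_add_distrib]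
        refine Finset.sum_le_sum fun i _ => ?_
        rw [(hM u).2 i]
        refine (norm_add_le _ _).trans (add_le_add (norm_mulL2_le hr hρ _)
          (norm_mulL2_le (hg i) ?_ _))
        filter_upwards [hC i] with x hx
        exact hx.trans (le_abs_self _)
      have h3 : ρ * ∑ i, ‖H10.deriv u i‖ ≤ θ * ∑ i, ‖H10.deriv u i‖ :=
        mul_le_mul_of_nonneg_right (by linarith) (by positivity)
      have h4 := mul_le_mul_of_nonneg_right hκ' (norm_nonneg (H10.toL2 Ω u))
      have h5 := mul_le_mul_of_nonneg_left h1 (zero_le_one.trans hκ)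
      simp only [N]
      linarith
  obtain ⟨P, hP⟩ := hs
  refine ⟨P, fun u => ?_⟩
  rw [← (hM _).1, ← map_sub, hP]

theorem isWeakDeriv_const_add_const_mul {i : Fin d} {m g : E d → ℂ} (hm : MemLp m ∞ (vol Ω))
    (h : IsWeakDeriv Ω i m g) (a c : ℂ) :
    IsWeakDeriv Ω i (fun x => a + c * m x) (fun x => c * g x) := by
  have hint : ∀ (q : E d → ℂ), MemLp q ∞ (vol Ω) → ∀ ψ : 𝓓(Ω, ℂ),
      Integrable (fun x => q x * ψ x) (vol Ω) := fun q hq ψ => by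
    have hψ : Integrable ψ (vol Ω) :=
      (ψ.continuous.integrable_of_hasCompactSupport ψ.hasCompactSupport).integrableOn
    exact (hψ.essSup_smul hq.aestronglyMeasurable hq.2.ne)
  intro φ
  -- Integration by parts against the constant `1`: the constant `a` contributes nothing.
  have h0 : ∫ x in (Ω : Set (E d)), testDeriv i φ x = 0 := by
    rw [setIntegral_eq_integral_of_forall_compl_eq_zero fun x hx =>
      image_eq_zero_of_notMem_tsupport (fun h => hx ((testDeriv i φ).tsupport_subset h))]
    have h1 := (testDeriv i φ).continuous.integrable_of_hasCompactSupport (μ := volume)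
      (testDeriv i φ).hasCompactSupport
    have h2 := φ.continuous.integrable_of_hasCompactSupport (μ := volume) φ.hasCompactSupport
    have := integral_mul_fderiv_eq_neg_fderiv_mul_of_integrable (μ := volume) (𝕜 := ℂ)
      (f := fun _ : E d => (1 : ℂ)) (g := φ) (v := e i) (by simp) (by simpa using! h1)
      (by simpa using h2) (fun x _ => differentiableAt_const 1)
      (fun x _ => (φ.contDiff.differentiable (by simp)) x)
    simpa using! this
  have h1 : Integrable (fun x => a * testDeriv i φ x) (vol Ω) :=
    (((testDeriv i φ).continuous.integrable_of_hasCompactSupport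
      (testDeriv i φ).hasCompactSupport).integrableOn).const_mul a
  simp only [add_mul, mul_assoc]
  rw [integral_add h1 ((hint m hm _).const_mul c), integral_const_mul, integral_const_mul,
    integral_const_mul, h0, h φ]
  ring

/-- Here `1 - r = m / R`, so `w - r w = u` means `w = (R / m) u`; scaling by `R⁻¹` yields `u / m`.
-/
theorem isProduct_inv_of_sub {m : E d → ℝ} {r : E d → ℂ} (hr : MemLp r ∞ (vol Ω)) {R : ℝ}
    (hR : 0 < R) (hrm : ∀ x, r x = (1 : ℂ) + (-(R⁻¹ : ℝ) : ℂ) * m x)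
    (hm : ∀ᵐ x ∂(vol Ω), 0 < m x) {u w : H10 Ω}
    (h : H10.toL2 Ω w - mulL2 hr (H10.toL2 Ω w) = H10.toL2 Ω u) :
    IsProduct (fun x => 1 / m x) u (((R⁻¹ : ℝ) : ℂ) • w) := by
  have h1 := Lp.coeFn_sub (H10.toL2 Ω w) (mulL2 hr (H10.toL2 Ω w))
  rw [h] at h1
  rw [IsProduct, map_smul]
  filter_upwards [h1, coeFn_mulL2 hr (H10.toL2 Ω w), hm,
    Lp.coeFn_smul ((R⁻¹ : ℝ) : ℂ) (H10.toL2 Ω w)] with x h3 h4 h5 h6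
  have hmx : (m x : ℂ) ≠ 0 := Complex.ofReal_ne_zero.2 h5.ne'
  have hRc : (R : ℂ) ≠ 0 := Complex.ofReal_ne_zero.2 hR.ne'
  rw [h6, h3, Pi.sub_apply, h4, Pi.smul_apply, smul_eq_mul, hrm x]
  push_cast
  field_simp
  ring

theorem memLp_const_add_const_mul {m : E d → ℂ} (hm : MemLp m ∞ (vol Ω)) (a c : ℂ) :
    MemLp (fun x => a + c * m x) ∞ (vol Ω) := by
  have h1 : MemLp (fun _ : E d => a) ∞ (vol Ω) := memLp_top_const a
  have h2 : MemLp (fun x => c * m x) ∞ (vol Ω) := hm.const_mul c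
  exact h1.add h2

/-- If `m ∈ W^{1,∞}(Ω)` is bounded below by a positive constant, then `1/m` is a multiplier of
`H₀¹(Ω)`. -/
theorem exists_isProduct_inv {m : E d → ℝ} (hm : MemW1Infty Ω m) {δ : ℝ} (hδ : 0 < δ)
    (hmδ : ∀ᵐ x ∂(vol Ω), δ ≤ m x) :
    ∃ P : H10 Ω →L[ℂ] H10 Ω, ∀ u, IsProduct (fun x => 1 / m x) u (P u) := by
  obtain ⟨hm0, hm1⟩ := hm
  choose g hg hmg using hm1
  obtain ⟨K, hK⟩ := hm0.exists_ae_norm_le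
  -- `R` bounds `m` from above, so `r = 1 - m / R ≥ 0`; also `δ ≤ R`, so the contraction bound `1 -
  -- δ / R` is nonnegative.
  obtain ⟨R, hKR, hδR⟩ : ∃ R : ℝ, K ≤ R ∧ δ ≤ R := ⟨max K δ, le_max_left _ _, le_max_right _ _⟩
  have hR : 0 < R := hδ.trans_le hδR
  have hmc : MemLp (fun x => (m x : ℂ)) ∞ (vol Ω) := hm0.ofReal
  have hgc : ∀ i, MemLp (fun x => (g i x : ℂ)) ∞ (vol Ω) := fun i => (hg i).ofReal
  have hr : MemLp (fun x => (1 : ℂ) + (-(R⁻¹ : ℝ) : ℂ) * m x) ∞ (vol Ω) :=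
    memLp_const_add_const_mul hmc 1 (-(R⁻¹ : ℝ) : ℂ)
  have hρ : ∀ᵐ x ∂(vol Ω), ‖(1 : ℂ) + (-(R⁻¹ : ℝ) : ℂ) * m x‖ ≤ 1 - δ / R := by
    filter_upwards [hK, hmδ] with x h1 h2
    have h3 : (1 : ℂ) + (-(R⁻¹ : ℝ) : ℂ) * m x = ((1 - m x / R : ℝ) : ℂ) := by
      push_cast
      ring
    have h4 : m x ≤ R := (le_abs_self _).trans (h1.trans hKR)
    rw [h3, Complex.norm_real, Real.norm_of_nonneg (sub_nonneg.2 ((div_le_one hR).2 h4))]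
    gcongr
  obtain ⟨P, hP⟩ := exists_inverse_one_sub hr (fun i => (hgc i).const_mul (-(R⁻¹ : ℝ) : ℂ))
    (fun i => isWeakDeriv_const_add_const_mul hmc (hmg i) 1 (-(R⁻¹ : ℝ) : ℂ))
    (sub_nonneg.2 ((div_le_one hR).2 hδR)) (sub_lt_self _ (div_pos hδ hR)) hρ
  refine ⟨((R⁻¹ : ℝ) : ℂ) • P, fun u => ?_⟩
  rw [smul_apply]
  exact isProduct_inv_of_sub hr hR (fun x => rfl) (hmδ.mono fun x hx => hδ.trans_le hx) (hP u)

theorem isProduct_add_const {q : E d → ℝ} {u w : H10 Ω} (h : IsProduct q u w) {q' : E d → ℝ}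
    {a c : ℝ} (hq : ∀ᵐ x ∂(vol Ω), q' x = a * q x + c) :
    IsProduct q' u ((a : ℂ) • w + (c : ℂ) • u) := by
  have h1 : H10.toL2 Ω ((a : ℂ) • w + (c : ℂ) • u) =
    (a : ℂ) • H10.toL2 Ω w + (c : ℂ) • H10.toL2 Ω u := rfl
  rw [IsProduct, h1]
  filter_upwards [Lp.coeFn_add ((a : ℂ) • H10.toL2 Ω w) ((c : ℂ) • H10.toL2 Ω u),
    Lp.coeFn_smul (a : ℂ) (H10.toL2 Ω w), Lp.coeFn_smul (c : ℂ) (H10.toL2 Ω u), h, hq]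
    with x h2 h3 h4 h5 h6
  rw [h2, Pi.add_apply, h3, h4, Pi.smul_apply, Pi.smul_apply, h5, h6]
  simp only [smul_eq_mul]
  push_cast
  ring

end Multipliers

/-! ### The variational problem in abstract Hilbert spaces -/

section Abstract

variable {X Y Z : Type*} [NormedAddCommGroup X] [InnerProductSpace ℂ X] [CompleteSpace X]
  [NormedAddCommGroup Y] [InnerProductSpace ℂ Y] [CompleteSpace Y]
  [NormedAddCommGroup Z] [InnerProductSpace ℂ Z] [CompleteSpace Z]

/-- The Riesz representative of a conjugate-linear functional. -/
theorem exists_riesz_conj (Y : Type*) [NormedAddCommGroup Y] [InnerProductSpace ℂ Y]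
    [CompleteSpace Y] :
    ∃ r : (Y →L⋆[ℂ] ℂ) →L[ℂ] Y, ∀ g v, inner ℂ v (r g) = g v := by
  let c : (Y →L⋆[ℂ] ℂ) → StrongDual ℂ Y := fun g =>
    (starL ℂ : ℂ ≃L⋆[ℂ] ℂ).toContinuousLinearMap.comp g
  have hc : ∀ g v, inner ℂ v ((InnerProductSpace.toDual ℂ Y).symm (c g)) = g v := by
    intro g v
    rw [← inner_conj_symm, InnerProductSpace.toDual_symm_apply]
    exact Complex.conj_conj (g v)
  refine ⟨LinearMap.mkContinuous
    { toFun := fun g => (InnerProductSpace.toDual ℂ Y).symm (c g)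
      map_add' := fun g h => ext_inner_left ℂ fun v => by
        rw [inner_add_right, hc, hc, hc]; rfl
      map_smul' := fun a g => ext_inner_left ℂ fun v => by
        rw [inner_smul_right, hc, RingHom.id_apply, hc]; rfl } 1 fun g => ?_, hc⟩
  change ‖(InnerProductSpace.toDual ℂ Y).symm (c g)‖ ≤ 1 * ‖g‖
  rw [LinearIsometryEquiv.norm_map]
  refine ContinuousLinearMap.opNorm_le_bound _ (by positivity) fun v => ?_
  rw [one_mul]
  exact (norm_star (g v)).trans_le (g.le_opNorm v)

/-- Lax–Milgram in operator form: coercivity makes `A` a unit of the algebra of bounded operators.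
-/
theorem exists_inverse_of_coercive {A : X →L[ℂ] X} {c : ℝ} (hc : 0 < c)
    (hA : ∀ u, c * ‖u‖ ^ 2 ≤ (inner ℂ u (A u)).re) :
    ∃ S : X →L[ℂ] X, ∀ u f, A u = f ↔ u = S f := by
  have hu : IsUnit A := by
    refine A.isUnit_of_forall_le_norm_inner_map (c := ⟨c, hc.le⟩) hc fun u => ?_
    rw [norm_inner_symm, mul_comm]
    exact (hA u).trans (Complex.re_le_norm _)
  obtain ⟨S, rfl⟩ := hu
  refine ⟨S.inv, fun u f => ⟨?_, ?_⟩⟩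
  · rintro rfl
    exact (congrArg (fun B : X →L[ℂ] X => B u) S.inv_val).symm
  · rintro rfl
    exact congrArg (fun B : X →L[ℂ] X => B f) S.val_inv

/-- Solvability of the variational problem `a(u, v) = b(F, v)`, where
`a(u, v) = (M L u, L v) + μ ∑ (D₂ u, D₂ v)` is coercive. -/
theorem exists_solution_operator {κ ν : Type*} [Fintype κ] [Fintype ν] (L : X →L[ℂ] Z)
    {M : Z →L[ℂ] Z} (hM : ∀ w, 0 ≤ (inner ℂ w (M w)).re) (D₂ : κ → X →L[ℂ] Z) {μ C : ℝ}
    (hμ : 0 < μ) (hC : 0 < C) (hD₂ : ∀ u, ‖u‖ ^ 2 ≤ C * ∑ p, ‖D₂ p u‖ ^ 2) (ι : X →L[ℂ] Y)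
    (D : ν → Y →L[ℂ] Z) (P Q : Y →L[ℂ] Y) :
    ∃ S : Y × (Y →L⋆[ℂ] ℂ) →L[ℂ] X, ∀ F u,
      (∀ v, inner ℂ (L v) (M (L u)) + μ * ∑ p, inner ℂ (D₂ p v) (D₂ p u) =
        ∑ i, inner ℂ (D i (ι v)) (D i (P F.1)) + ∑ i, inner ℂ (D i (Q (ι v))) (D i F.1) -
          F.2 (Q (ι v))) ↔ u = S F := by
  obtain ⟨r, hr⟩ := exists_riesz_conj Y
  -- Adjoints and the Riesz map represent both sides by bounded operators: the problem becomes `A u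
  -- = R F`.
  let A : X →L[ℂ] X := (ContinuousLinearMap.adjoint L).comp (M.comp L) +
    (μ : ℂ) • ∑ p, (ContinuousLinearMap.adjoint (D₂ p)).comp (D₂ p)
  have hA : ∀ u v, inner ℂ v (A u) =
      inner ℂ (L v) (M (L u)) + μ * ∑ p, inner ℂ (D₂ p v) (D₂ p u) := by
    intro u v
    simp only [A, add_apply, ContinuousLinearMap.comp_apply, smul_apply, sum_apply,
      inner_add_right, inner_smul_right, inner_sum, ContinuousLinearMap.adjoint_inner_right]
  have hcoer : ∀ u, μ / C * ‖u‖ ^ 2 ≤ (inner ℂ u (A u)).re := by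
    intro u
    have h1 : ∑ p, inner ℂ (D₂ p u) (D₂ p u) = ((∑ p, ‖D₂ p u‖ ^ 2 : ℝ) : ℂ) := by
      rw [Complex.ofReal_sum]
      refine Finset.sum_congr rfl fun p _ => ?_
      rw [inner_self_eq_norm_sq_to_K]
      norm_cast
    rw [hA, h1, Complex.add_re, ← Complex.ofReal_mul, Complex.ofReal_re]
    have h2 : μ / C * ‖u‖ ^ 2 ≤ μ * ∑ p, ‖D₂ p u‖ ^ 2 := by
      calc _ ≤ μ / C * (C * ∑ p, ‖D₂ p u‖ ^ 2) := by gcongr; exact hD₂ u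
        _ = _ := by field_simp
    linarith [hM (L u)]
  obtain ⟨S, hS⟩ := exists_inverse_of_coercive (div_pos hμ hC) hcoer
  let R : Y × (Y →L⋆[ℂ] ℂ) →L[ℂ] X :=
    (∑ i, (ContinuousLinearMap.adjoint ((D i).comp ι)).comp ((D i).comp P) +
      ∑ i, (ContinuousLinearMap.adjoint ((D i).comp (Q.comp ι))).comp (D i)).comp
        (ContinuousLinearMap.fst ℂ Y (Y →L⋆[ℂ] ℂ)) -
    ((ContinuousLinearMap.adjoint (Q.comp ι)).comp r).comp
      (ContinuousLinearMap.snd ℂ Y (Y →L⋆[ℂ] ℂ))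
  have hR : ∀ F v, inner ℂ v (R F) = ∑ i, inner ℂ (D i (ι v)) (D i (P F.1)) +
      ∑ i, inner ℂ (D i (Q (ι v))) (D i F.1) - F.2 (Q (ι v)) := by
    intro F v
    simp only [R, sub_apply, add_apply, ContinuousLinearMap.comp_apply, sum_apply,
      inner_add_right, inner_sub_right, inner_sum, ContinuousLinearMap.adjoint_inner_right, hr,
      ContinuousLinearMap.coe_fst', ContinuousLinearMap.coe_snd']
  refine ⟨S.comp R, fun F u => ?_⟩
  rw [ContinuousLinearMap.comp_apply, ← hS]
  constructor
  · intro h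
    refine ext_inner_left ℂ fun v => ?_
    rw [hA, hR, h]
  · intro h v
    rw [← hA, ← hR, h]

/-- Solvability of the variational problem `a(u, v) + (ω, z) = b(F, v) + (J F₁, z)` for the pair
`(u, ω)`. -/
theorem exists_solution_operator_prod {κ ν : Type*} [Fintype κ] [Fintype ν] (L : X →L[ℂ] Z)
    {M : Z →L[ℂ] Z} (hM : ∀ w, 0 ≤ (inner ℂ w (M w)).re) (D₂ : κ → X →L[ℂ] Z) {μ C : ℝ}
    (hμ : 0 < μ) (hC : 0 < C) (hD₂ : ∀ u, ‖u‖ ^ 2 ≤ C * ∑ p, ‖D₂ p u‖ ^ 2) (ι : X →L[ℂ] Y)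
    (D : ν → Y →L[ℂ] Z) (P Q : Y →L[ℂ] Y) (J : Y →L[ℂ] Z) :
    ∃ T : Y × (Y →L⋆[ℂ] ℂ) →L[ℂ] X × Z, ∀ (F : Y × (Y →L⋆[ℂ] ℂ)) (U : X × Z), (∀ V : X × Z,
      inner ℂ (L V.1) (M (L U.1)) + μ * ∑ p, inner ℂ (D₂ p V.1) (D₂ p U.1) + inner ℂ V.2 U.2 =
        (∑ i, inner ℂ (D i (ι V.1)) (D i (P F.1)) + ∑ i, inner ℂ (D i (Q (ι V.1))) (D i F.1) -
          F.2 (Q (ι V.1))) + inner ℂ V.2 (J F.1)) ↔ U = T F := by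
  obtain ⟨S, hS⟩ := exists_solution_operator L hM D₂ hμ hC hD₂ ι D P Q
  refine ⟨S.prod (J.comp (ContinuousLinearMap.fst ℂ Y (Y →L⋆[ℂ] ℂ))), fun F U => ?_⟩
  rw [Prod.ext_iff]
  constructor
  · intro h
    constructor
    · refine (hS F U.1).1 fun v => ?_
      have hv := h (v, 0)
      simpa only [inner_zero_left, add_zero] using hv
    · refine ext_inner_left ℂ fun z => ?_
      have hz := h (0, z)
      simpa using hz
  · rintro ⟨h1, h2⟩ V
    rw [(hS F U.1).2 h1 V.1, h2]
    rfl

end Abstract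

/-! ### The forms `A` and `B` -/

theorem MemW1Infty.const_add_const_mul {n : E d → ℝ} (hn : MemW1Infty Ω n) (a c : ℝ) :
    MemW1Infty Ω fun x => a + c * n x := by
  obtain ⟨h0, h1⟩ := hn
  have hc : MemLp (fun _ : E d => a) ∞ (vol Ω) := memLp_top_const a
  refine ⟨hc.add (h0.const_mul c), fun i => ?_⟩
  obtain ⟨g, hg, hng⟩ := h1 i
  refine ⟨fun x => c * g x, hg.const_mul c, ?_⟩
  have h := isWeakDeriv_const_add_const_mul (m := fun x => (n x : ℂ)) h0.ofReal hng (a : ℂ) (c : ℂ)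
  intro φ
  simpa using h φ

theorem re_inner_mulL2_nonneg {q : E d → ℝ} (hq : MemLp (fun x => (q x : ℂ)) ∞ (vol Ω))
    (h0 : ∀ᵐ x ∂(vol Ω), 0 ≤ q x) (w : L2 Ω) : 0 ≤ (inner ℂ w (mulL2 hq w)).re := by
  have h : inner ℂ w (mulL2 hq w) =
      ((∫ x in (Ω : Set (E d)), q x * ‖w x‖ ^ 2 : ℝ) : ℂ) := by
    rw [inner_eq_integral, ← integral_complex_ofReal]
    refine integral_congr_ae ?_
    filter_upwards [coeFn_mulL2 hq w] with x hx
    rw [hx, mul_assoc, Complex.mul_conj']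
    push_cast
    rfl
  rw [h, Complex.ofReal_re]
  refine integral_nonneg_of_ae ?_
  filter_upwards [h0] with x hx
  positivity

theorem integrable_mul_conj (u v : L2 Ω) : Integrable (fun x => u x * conj (v x)) (vol Ω) :=
  L2.integrable_inner (𝕜 := ℂ) v u

theorem integral_sum_mul_conj {κ : Type*} [Fintype κ] (u v : κ → L2 Ω) :
    ∫ x in (Ω : Set (E d)), ∑ i, u i x * conj (v i x) = ∑ i, inner ℂ (v i) (u i) := by
  rw [integral_finsetSum _ fun i _ => integrable_mul_conj (u i) (v i)]
  simp only [inner_eq_integral]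

/-- The Laplacian as an operator `H₀²(Ω) → L²(Ω)`. -/
def laplacianL (Ω : Opens (E d)) : H20 Ω →L[ℂ] L2 Ω := ∑ i, deriv2L i i

theorem laplacianL_apply (u : H20 Ω) : laplacianL Ω u = H20.laplacian u := by
  rw [laplacianL, sum_apply]
  rfl

theorem formA_eq {m : E d → ℝ} {μ : ℝ}
    (hq : MemLp (fun x => ((1 / m x - μ : ℝ) : ℂ)) ∞ (vol Ω)) (U V : HH Ω) :
    formA Ω m μ U V = inner ℂ (laplacianL Ω V.1) (mulL2 hq (laplacianL Ω U.1)) +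
      μ * ∑ p : Fin d × Fin d, inner ℂ (deriv2L p.1 p.2 V.1) (deriv2L p.1 p.2 U.1) +
      inner ℂ V.2 U.2 := by
  have h2 : (∫ x in (Ω : Set (E d)), ∑ i, ∑ j,
      H20.deriv2 U.1 i j x * conj (H20.deriv2 V.1 i j x)) =
      ∑ p : Fin d × Fin d, inner ℂ (deriv2L p.1 p.2 V.1) (deriv2L p.1 p.2 U.1) := by
    rw [← integral_sum_mul_conj (fun p : Fin d × Fin d => deriv2L p.1 p.2 U.1)
      (fun p => deriv2L p.1 p.2 V.1)]
    simp only [Fintype.sum_prod_type]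
    rfl
  rw [formA, h2, ← inner_eq_integral, inner_eq_integral (laplacianL Ω V.1), laplacianL_apply,
    laplacianL_apply]
  congr 2
  refine integral_congr_ae ?_
  filter_upwards [coeFn_mulL2 hq (H20.laplacian U.1)] with x hx
  rw [hx]

theorem formB_eq {n m : E d → ℝ} {P Q : H10 Ω →L[ℂ] H10 Ω}
    (hP : ∀ u, IsProduct (fun x => 1 / m x) u (P u))
    (hQ : ∀ u, IsProduct (fun x => n x / m x) u (Q u)) (F : HH1 Ω) (V : HH Ω) :
    formB Ω n m F V = (∑ i, inner ℂ (derivL i (H20.toH10 Ω V.1)) (derivL i (P F.1)) +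
      ∑ i, inner ℂ (derivL i (Q (H20.toH10 Ω V.1))) (derivL i F.1) -
      F.2 (Q (H20.toH10 Ω V.1))) + inner ℂ V.2 (H10.toL2 Ω F.1) := by
  rw [formB, (hP _).mulH10_eq, (hQ _).mulH10_eq, ← inner_eq_integral]
  congr 3
  · exact integral_sum_mul_conj (fun i => derivL i (P F.1)) fun i => derivL i (H20.toH10 Ω V.1)
  · exact integral_sum_mul_conj (fun i => derivL i F.1) fun i => derivL i (Q (H20.toH10 Ω V.1))

/-! ### Assembly of the solution operator -/

theorem exists_solution {n m : E d → ℝ} {μ : ℝ} [NeZero d]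
    (hΩ : Bornology.IsBounded (Ω : Set (E d))) (hμ : 0 < μ)
    (hμm : ∀ᵐ x ∂(vol Ω), μ ≤ 1 / m x)
    (hq : MemLp (fun x => ((1 / m x - μ : ℝ) : ℂ)) ∞ (vol Ω)) {P Q : H10 Ω →L[ℂ] H10 Ω}
    (hP : ∀ u, IsProduct (fun x => 1 / m x) u (P u))
    (hQ : ∀ u, IsProduct (fun x => n x / m x) u (Q u)) :
    ∃ T : HH1 Ω →L[ℂ] HH Ω, ∀ (F : HH1 Ω) (Y : HH Ω),
      (∀ V : HH Ω, formA Ω m μ Y V = formB Ω n m F V) ↔ Y = T F := by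
  obtain ⟨C, hC, hC'⟩ := exists_norm_sq_H20_le hΩ
  have h1 := exists_solution_operator_prod (κ := Fin d × Fin d) (ν := Fin d) (X := H20 Ω)
    (Y := H10 Ω) (Z := L2 Ω) (laplacianL Ω) (M := mulL2 hq)
    (re_inner_mulL2_nonneg hq (hμm.mono fun x hx => sub_nonneg.2 hx))
    (fun p => deriv2L p.1 p.2) (μ := μ) (C := C) hμ hC
  have h2 := h1 hC' (H20.toH10 Ω) (fun i => derivL i) P Q (H10.toL2 Ω)
  obtain ⟨T, hT⟩ := h2
  refine ⟨T, fun F Y => ?_⟩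
  simp only [formA_eq hq, formB_eq hP hQ]
  exact hT F Y

/-- The constant `a` treats both cases at once: `a = 1` under (C1), `a = -1` under (C2). As `n/m` is
`1/m` plus a constant, its multiplier `Q` is obtained directly from `P`. -/
theorem exists_products_and_solution {n m : E d → ℝ} {μ δ a : ℝ} [NeZero d]
    (hΩ : Bornology.IsBounded (Ω : Set (E d))) (hm : MemW1Infty Ω m) (hδ : 0 < δ)
    (hmδ : ∀ᵐ x ∂(vol Ω), δ ≤ m x) (hnm : ∀ᵐ x ∂(vol Ω), n x / m x = 1 * (1 / m x) + a)
    (hμ : 0 < μ) (hμm : ∀ᵐ x ∂(vol Ω), μ ≤ 1 / m x) :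
    (∀ f : H10 Ω, ∃! w : H10 Ω, IsProduct (fun x => 1 / m x) f w) ∧
    (∀ v : H10 Ω, ∃! w : H10 Ω, IsProduct (fun x => n x / m x) v w) ∧
    ∃ T : HH1 Ω →L[ℂ] HH Ω,
      (∀ (F : HH1 Ω) (Y : HH Ω), (∀ V : HH Ω, formA Ω m μ Y V = formB Ω n m F V) ↔ Y = T F) ∧
      IsCompactOperator (T ∘L incl Ω) ∧
      IsCompactOperator (incl Ω ∘L T) := by
  obtain ⟨P, hP⟩ := exists_isProduct_inv hm hδ hmδ
  let Q : H10 Ω →L[ℂ] H10 Ω := ((1 : ℝ) : ℂ) • P + (a : ℂ) • ContinuousLinearMap.id ℂ (H10 Ω)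
  have hQ : ∀ u, IsProduct (fun x => n x / m x) u (Q u) := fun u =>
    isProduct_add_const (hP u) hnm
  have hq : MemLp (fun x => ((1 / m x - μ : ℝ) : ℂ)) ∞ (vol Ω) := by
    have h : MemLp (fun x => 1 / m x - μ) ∞ (vol Ω) := by
      refine memLp_top_of_bound
        ((hm.1.aestronglyMeasurable.aemeasurable.const_div 1).sub_const μ).aestronglyMeasurable
        (1 / δ) ?_
      filter_upwards [hmδ, hμm] with x h1 h2
      have h3 : 1 / m x ≤ 1 / δ := one_div_le_one_div_of_le hδ h1
      rw [Real.norm_of_nonneg (sub_nonneg.2 h2)]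
      linarith
    exact h.ofReal
  obtain ⟨T, hT⟩ := exists_solution hΩ hμ hμm hq hP hQ
  exact ⟨fun f => ⟨P f, hP f, fun w hw => hw.unique (hP f)⟩,
    fun v => ⟨Q v, hQ v, fun w hw => hw.unique (hQ v)⟩, T, hT,
    (isCompactOperator_incl hΩ).clm_comp T, (isCompactOperator_incl hΩ).comp_clm T⟩

end TransmissionEigenvalue

end

open TransmissionEigenvalue in
theorem theorem2p2 (d : ℕ) (hd : d = 2 ∨ d = 3)
    (Ω : TopologicalSpace.Opens (EuclideanSpace ℝ (Fin d)))
    (hΩb : Bornology.IsBounded (Ω : Set (EuclideanSpace ℝ (Fin d))))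
    (hΩc : SimplyConnectedSpace Ω)
    (n m : EuclideanSpace ℝ (Fin d) → ℝ)
    (hn : MemW1Infty Ω n)
    (hm : (CondC1 Ω n ∧ m = fun x => n x - 1) ∨ (CondC2 Ω n ∧ m = fun x => 1 - n x))
    (μ : ℝ) (hμ : 0 < μ) (hμm : ∀ᵐ x ∂(vol Ω), μ ≤ 1 / m x) :
    -- the products occurring in `B` are well defined elements of `H₀¹(Ω)`
    (∀ f : H10 Ω, ∃! w : H10 Ω, IsProduct (fun x => 1 / m x) f w) ∧
    (∀ v : H10 Ω, ∃! w : H10 Ω, IsProduct (fun x => n x / m x) v w) ∧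
    -- the solution operator exists, and is compact on both spaces
    ∃ T : HH1 Ω →L[ℂ] HH Ω,
      (∀ (F : HH1 Ω) (Y : HH Ω), (∀ V : HH Ω, formA Ω m μ Y V = formB Ω n m F V) ↔ Y = T F) ∧
      IsCompactOperator (T ∘L incl Ω) ∧
      IsCompactOperator (incl Ω ∘L T) := by
  -- The Poincaré inequality uses the coordinate direction `0`.
  have : NeZero d := ⟨by omega⟩
  rcases hm with ⟨⟨-, δ, hδ, hnδ⟩, rfl⟩ | ⟨⟨-, -, β, hβ, hnβ⟩, rfl⟩
  · have hm : MemW1Infty Ω fun x => n x - 1 := by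
      convert hn.const_add_const_mul (-1) 1 using 2
      ring
    refine exists_products_and_solution (δ := δ) (a := 1) hΩb hm hδ ?_ ?_ hμ hμm
    · filter_upwards [hnδ] with x hx
      linarith
    · filter_upwards [hnδ] with x hx
      have : n x - 1 ≠ 0 := by linarith
      field_simp
      ring
  · have hm : MemW1Infty Ω fun x => 1 - n x := by
      convert hn.const_add_const_mul 1 (-1) using 2
      ring
    refine exists_products_and_solution (δ := β) (a := -1) hΩb hm hβ ?_ ?_ hμ hμm
    · filter_upwards [hnβ] with x hx
      linarith
    · filter_upwards [hnβ] with x hx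
      have : 1 - n x ≠ 0 := by linarith
      field_simp
      ring
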